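/- Let $L>0$, $n\ge 1$, and let $\mathcal L u=\sum_{j=0}^{n}a_j(x)\,u^{(j)}$ be a differential expression with smooth real coefficients on $[0,L]$ and $a_n(x)\neq 0$ for all $x\in[0,L]$. Impose on $\mathbf u=(u,u',\dots,u^{(n-1)})^T$ either separated boundary conditions $B_L\mathbf u(0)=0$, $B_R\mathbf u(L)=0$, where $B_L\in\mathbb R^{k\times n}$ and $B_R\in\mathbb R^{(n-k)\times n}$ have full rank and $0<k<n$, or periodic boundary conditions $\mathbf u(0)=\mathbf u(L)$. Regard $\mathcal L$ as an unbounded operator on $L^2([0,L];\mathbb C)$ whose domain is the set of $u\in H^n(0,L)$ satisfying the boundary conditions, and assume that $\mathcal L$ is self-adjoint. Let $\rho(\mathcal L)$ be its resolvent set and $\sigma(\mathcal L)=\mathbb C\setminus\rho(\mathcal L)$ its spectrum. For $\lambda\in\mathbb R$ write $(\mathcal L-\lambda)u=0$ as the first order system $\mathbf u'=A(x,\lambda)\mathbf u$, let $U(x)=U(x;\lambda)$ be its fundamental matrix with $U(0)=I$, and let $M=U(L)$. In the separated case let the columns of $N_L\in\mathbb R^{n\times(n-k)}$ be a fixed basis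 of the null space of $B_L$ and put $$E(\lambda)=\det(B_RMN_L),\qquad P=N_L\,\mathrm{adj}(B_RMN_L)\,B_RM ;$$ in the periodic case put $E(\lambda)=\det(M-I)$ and $P=\mathrm{adj}(M-I)\,M$. Let $$\mathcal G(x,y,\lambda)=\begin{cases}U(x)\,(E(\lambda)I-P)\,U(y)^{-1}, & y<x,\\ -U(x)\,P\,U(y)^{-1}, & y>x,\end{cases}\qquad G(x,y,\lambda)=\frac{[\mathcal G(x,y,\lambda)]_{1n}}{a_n(y)},$$ and define the weight $W(\lambda)=\left(\int_0^L\!\int_0^L G(x,y,\lambda)^2\,dy\,dx\right)^{1/2}$. Let $\lambda_0\in\rho(\mathcal L)\cap\mathbb R$ with $E(\lambda_0)>0$, and define $\lambda_0^{\pm}=\lambda_0$ and $$\lambda_{i+1}^{\pm}=\lambda_i^{\pm}\pm\frac{E(\lambda_i^{\pm})}{W(\lambda_i^{\pm})}\qquad(i\ge 0).$$ Then the sequence $(\lambda_i^+)$ is strictly increasing and the sequence $(\lambda_i^-)$ is strictly decreasing. If $\lambda^+=\min\{x\in\sigma(\mathcal L)\cap\mathbb R: x>\lambda_0\}$ exists,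 then $\lambda_i^+\to\lambda^+$; if $\lambda^-=\max\{x\in\sigma(\mathcal L)\cap\mathbb R: x<\lambda_0\}$ exists, then $\lambda_i^-\to\lambda^-$. -/

import Mathlib

open MeasureTheory Filter Topology
open scoped ContDiff

noncomputable section

namespace EvansNewton

/-- A real linear ordinary differential expression
`u ↦ a 0 * u + a 1 * u' + ⋯ + a n * u⁽ⁿ⁾` of order `n ≥ 1` on the compact interval `[0, L]`,
with smooth real coefficients and nonvanishing leading coefficient. -/
structure RealDiffExpr where
  L : ℝ
  L_pos : 0 < L
  n : ℕ
  n_pos : 0 < n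
  a : Fin (n + 1) → ℝ → ℝ
  smooth : ∀ j, ContDiffOn ℝ ∞ (a j) (Set.Icc 0 L)
  lead_ne_zero : ∀ x ∈ Set.Icc 0 L, a (Fin.last n) x ≠ 0

/-- Separated boundary conditions `BL u(0) = 0`, `BR u(L) = 0` on the vector
`(u, u', …, u⁽ⁿ⁻¹⁾)`, with `k` conditions on the left and `m = n - k` on the right, `0 < k < n`,
both matrices of full rank, together with the basis of the null space of `BL` (the columns of `NL`)
that normalizes the Evans function. -/
structure SeparatedBC (n : ℕ) where
  k : ℕ
  m : ℕ
  k_pos : 0 < k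
  m_pos : 0 < m
  add_eq : k + m = n
  BL : Matrix (Fin k) (Fin n) ℝ
  BR : Matrix (Fin m) (Fin n) ℝ
  NL : Matrix (Fin n) (Fin m) ℝ
  BL_full : LinearIndependent ℝ BL.row
  BR_full : LinearIndependent ℝ BR.row
  BL_mul_NL : BL * NL = 0
  NL_indep : LinearIndependent ℝ NL.col

/-- Separated or periodic boundary conditions for an operator of order `n`. -/
inductive BoundaryCondition (n : ℕ) where
  | separated (b : SeparatedBC n)
  | periodic

/-- The boundary condition, for `p = (u, …, u⁽ⁿ⁻¹⁾)(0)` and `q = (u, …, u⁽ⁿ⁻¹⁾)(L)`. -/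
def BoundaryCondition.Holds {n : ℕ} (bc : BoundaryCondition n) (p q : Fin n → ℂ) : Prop :=
  match bc with
  | .separated b =>
      (b.BL.map (fun r => (r : ℂ))).mulVec p = 0 ∧ (b.BR.map (fun r => (r : ℂ))).mulVec q = 0
  | .periodic => p = q

/-! ### The operator on `L²` and its spectrum -/

/-- The Hilbert space `L²([0, L]; ℂ)`. -/
abbrev H (D : RealDiffExpr) : Type := Lp ℂ 2 ((volume : Measure ℝ).restrict (Set.Icc 0 D.L))

/-- `v 0, …, v n` are `u, u', …, u⁽ⁿ⁾` for a function `u` in the Sobolev space `Hⁿ(0, L)`: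
each `v j` with `j < n` is an antiderivative of `v (j + 1)` (so `v 0, …, v (n - 1)` are absolutely
continuous), and `v n` is square integrable. -/
structure IsSobolevJet (D : RealDiffExpr) (v : Fin (D.n + 1) → ℝ → ℂ) : Prop where
  integrable : ∀ j : Fin D.n, IntervalIntegrable (v j.succ) volume 0 D.L
  antideriv : ∀ j : Fin D.n, ∀ x ∈ Set.Icc 0 D.L,
    v j.castSucc x = v j.castSucc 0 + ∫ t in (0 : ℝ)..x, v j.succ t
  memLp : MemLp (v (Fin.last D.n)) 2 ((volume : Measure ℝ).restrict (Set.Icc 0 D.L))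

/-- `u` lies in the domain (it is in `Hⁿ(0, L)` and satisfies the boundary conditions) and the
differential expression applied to `u` is `f`. -/
def InGraph (D : RealDiffExpr) (bc : BoundaryCondition D.n) (u f : H D) : Prop :=
  ∃ v : Fin (D.n + 1) → ℝ → ℂ, IsSobolevJet D v ∧
    (u : ℝ → ℂ) =ᵐ[(volume : Measure ℝ).restrict (Set.Icc 0 D.L)] v 0 ∧
    (f : ℝ → ℂ) =ᵐ[(volume : Measure ℝ).restrict (Set.Icc 0 D.L)]
      (fun x => ∑ j, (D.a j x : ℂ) * v j x) ∧
    bc.Holds (fun j => v j.castSucc 0) (fun j => v j.castSucc D.L)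

theorem IsSobolevJet.add {D : RealDiffExpr} {v w : Fin (D.n + 1) → ℝ → ℂ}
    (hv : IsSobolevJet D v) (hw : IsSobolevJet D w) :
    IsSobolevJet D (fun j x => v j x + w j x) where
  integrable j := (hv.integrable j).add (hw.integrable j)
  antideriv j x hx := by
    have hsub : Set.uIcc 0 x ⊆ Set.uIcc 0 D.L := by
      rw [Set.uIcc_of_le hx.1, Set.uIcc_of_le D.L_pos.le]
      exact Set.Icc_subset_Icc_right hx.2
    rw [intervalIntegral.integral_add ((hv.integrable j).mono_set hsub)
      ((hw.integrable j).mono_set hsub), hv.antideriv j x hx, hw.antideriv j x hx]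
    ring
  memLp := hv.memLp.add hw.memLp

theorem IsSobolevJet.smul {D : RealDiffExpr} {v : Fin (D.n + 1) → ℝ → ℂ}
    (hv : IsSobolevJet D v) (c : ℂ) : IsSobolevJet D (fun j x => c * v j x) where
  integrable j := (hv.integrable j).const_mul c
  antideriv j x hx := by
    rw [intervalIntegral.integral_const_mul, hv.antideriv j x hx]
    ring
  memLp := hv.memLp.const_mul c

theorem BoundaryCondition.Holds.add {n : ℕ} {bc : BoundaryCondition n} {p q p' q' : Fin n → ℂ}
    (h : bc.Holds p q) (h' : bc.Holds p' q') :
    bc.Holds (fun j => p j + p' j) (fun j => q j + q' j) := by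
  cases bc with
  | separated b =>
    refine ⟨(Matrix.mulVec_add _ p p').trans ?_, (Matrix.mulVec_add _ q q').trans ?_⟩
    · rw [h.1, h'.1, add_zero]
    · rw [h.2, h'.2, add_zero]
  | periodic =>
    have h1 : p = q := h
    have h2 : p' = q' := h'
    subst h1 h2
    rfl

theorem BoundaryCondition.Holds.smul {n : ℕ} {bc : BoundaryCondition n} {p q : Fin n → ℂ}
    (h : bc.Holds p q) (c : ℂ) : bc.Holds (fun j => c * p j) (fun j => c * q j) := by
  cases bc with
  | separated b =>
    refine ⟨(Matrix.mulVec_smul _ c p).trans ?_, (Matrix.mulVec_smul _ c q).trans ?_⟩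
    · rw [h.1, smul_zero]
    · rw [h.2, smul_zero]
  | periodic =>
    have h1 : p = q := h
    subst h1
    rfl

/-- The graph of the operator, as a subspace of `L² × L²`. -/
def graph (D : RealDiffExpr) (bc : BoundaryCondition D.n) : Submodule ℂ (H D × H D) where
  carrier := {z | InGraph D bc z.1 z.2}
  zero_mem' := by
    refine ⟨fun _ _ => 0, ⟨fun _ => by simp, fun _ _ _ => by simp, by simp⟩, ?_, ?_, ?_⟩
    · exact Lp.coeFn_zero _ _ _
    · filter_upwards [Lp.coeFn_zero ℂ 2 ((volume : Measure ℝ).restrict (Set.Icc 0 D.L))] with x hx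
      simpa using hx
    · cases bc with
      | separated b => exact ⟨Matrix.mulVec_zero _, Matrix.mulVec_zero _⟩
      | periodic => exact rfl
  add_mem' := by
    rintro ⟨u, f⟩ ⟨u', f'⟩ ⟨v, hv, hu, hf, hb⟩ ⟨v', hv', hu', hf', hb'⟩
    refine ⟨_, hv.add hv', ?_, ?_, hb.add hb'⟩
    · filter_upwards [Lp.coeFn_add u u', hu, hu'] with x h h1 h2
      simpa [h1, h2] using h
    · filter_upwards [Lp.coeFn_add f f', hf, hf'] with x h h1 h2
      refine h.trans ?_
      simp [h1, h2, mul_add, Finset.sum_add_distrib]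
  smul_mem' := by
    rintro c ⟨u, f⟩ ⟨v, hv, hu, hf, hb⟩
    refine ⟨_, hv.smul c, ?_, ?_, hb.smul c⟩
    · filter_upwards [Lp.coeFn_smul c u, hu] with x h h1
      simpa [h1] using h
    · filter_upwards [Lp.coeFn_smul c f, hf] with x h h1
      refine h.trans ?_
      simp [h1, Finset.mul_sum, mul_left_comm]

/-- The differential operator with domain `{u ∈ Hⁿ(0, L) | boundary conditions}`, as an unbounded
operator on `L²([0, L]; ℂ)`. -/
def operator (D : RealDiffExpr) (bc : BoundaryCondition D.n) : H D →ₗ.[ℂ] H D :=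
  (graph D bc).toLinearPMap

/-- The resolvent set of an unbounded operator: the `z` for which `T - z` has a bounded,
everywhere defined, two-sided inverse. -/
def resolventSet {E : Type*} [NormedAddCommGroup E] [NormedSpace ℂ E] (T : E →ₗ.[ℂ] E) : Set ℂ :=
  {z | ∃ R : E →L[ℂ] E, (∀ f : E, ∃ u : T.domain, (u : E) = R f ∧ T u - z • (u : E) = f) ∧
    ∀ u : T.domain, R (T u - z • (u : E)) = u}

/-- The spectrum: the complement of the resolvent set. -/
def spectrum {E : Type*} [NormedAddCommGroup E] [NormedSpace ℂ E] (T : E →ₗ.[ℂ] E) : Set ℂ :=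
  (resolventSet T)ᶜ

/-! ### The Evans function and its weight, for a real spectral parameter -/

/-- The matrix `A(x, z)` of the first order system `U' = A(x, z) U` for `(u, u', …, u⁽ⁿ⁻¹⁾)` that is
equivalent to `a 0 * u + ⋯ + a n * u⁽ⁿ⁾ = z * u`. -/
def companion (D : RealDiffExpr) (z x : ℝ) : Matrix (Fin D.n) (Fin D.n) ℝ :=
  Matrix.of fun i j =>
    if (i : ℕ) + 1 < D.n then (if (j : ℕ) = i + 1 then 1 else 0)
    else ((if (j : ℕ) = 0 then z else 0) - D.a j.castSucc x) / D.a (Fin.last D.n) x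

/-- `U` solves `U' = A(x, z) U` on `[0, L]` with `U(0) = 1`. -/
def IsFundamentalMatrix (D : RealDiffExpr) (z : ℝ) (U : ℝ → Matrix (Fin D.n) (Fin D.n) ℝ) : Prop :=
  U 0 = 1 ∧ ∀ x ∈ Set.Icc 0 D.L, ∀ i j,
    HasDerivWithinAt (fun t => U t i j) ((companion D z x * U x) i j) (Set.Icc 0 D.L) x

/-- The fundamental matrix solution (uniquely determined on `[0, L]`). -/
def fundamental (D : RealDiffExpr) (z : ℝ) : ℝ → Matrix (Fin D.n) (Fin D.n) ℝ :=
  Classical.epsilon (IsFundamentalMatrix D z)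

/-- The monodromy matrix `M = U(L)`. -/
def monodromy (D : RealDiffExpr) (z : ℝ) : Matrix (Fin D.n) (Fin D.n) ℝ :=
  fundamental D z D.L

/-- The Evans function: `det (BR M NL)` for separated and `det (M - 1)` for periodic boundary
conditions. -/
def evans (D : RealDiffExpr) (bc : BoundaryCondition D.n) (z : ℝ) : ℝ :=
  match bc with
  | .separated b => (b.BR * monodromy D z * b.NL).det
  | .periodic => (monodromy D z - 1).det

/-- The matrix `P`, equal to `E NL (BR M NL)⁻¹ BR M`, respectively `E (M - 1)⁻¹ M`, where the Evans
function `E` does not vanish. -/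
def projector (D : RealDiffExpr) (bc : BoundaryCondition D.n) (z : ℝ) :
    Matrix (Fin D.n) (Fin D.n) ℝ :=
  match bc with
  | .separated b =>
      b.NL * (b.BR * monodromy D z * b.NL).adjugate * b.BR * monodromy D z
  | .periodic => (monodromy D z - 1).adjugate * monodromy D z

/-- The matrix kernel: `U(x) (E - P) U(y)⁻¹` for `y < x` and `-U(x) P U(y)⁻¹` for `y > x`. -/
def greenMatrix (D : RealDiffExpr) (bc : BoundaryCondition D.n) (z x y : ℝ) :
    Matrix (Fin D.n) (Fin D.n) ℝ :=
  if y < x then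
    fundamental D z x * (evans D bc z • (1 : Matrix (Fin D.n) (Fin D.n) ℝ) - projector D bc z) *
      (fundamental D z y)⁻¹
  else -(fundamental D z x * projector D bc z * (fundamental D z y)⁻¹)

/-- The kernel `G` with `(𝓛 - z)⁻¹ f (x) = E(z)⁻¹ ∫ G(x, y) f(y) dy`. It is the entry in the first
row and last column of the matrix kernel, divided by the leading coefficient, since
`(𝓛 - z) u = f` is the first order system with forcing term `(0, …, 0, f / a n)`. -/
def greenKernel (D : RealDiffExpr) (bc : BoundaryCondition D.n) (z x y : ℝ) : ℝ :=
  greenMatrix D bc z x y ⟨0, D.n_pos⟩ ⟨D.n - 1, Nat.sub_lt D.n_pos Nat.one_pos⟩ /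
    D.a (Fin.last D.n) y

/-- The weight `W = (∫∫ G²)^(1/2)`. -/
def weight (D : RealDiffExpr) (bc : BoundaryCondition D.n) (z : ℝ) : ℝ :=
  Real.sqrt (∫ x in (0 : ℝ)..D.L, ∫ y in (0 : ℝ)..D.L, greenKernel D bc z x y ^ 2)

/-- The iteration `z ↦ z + E(z) / W(z)` started at `z₀`. -/
def iterPlus (D : RealDiffExpr) (bc : BoundaryCondition D.n) (z₀ : ℝ) : ℕ → ℝ
  | 0 => z₀
  | i + 1 => iterPlus D bc z₀ i +
      evans D bc (iterPlus D bc z₀ i) / weight D bc (iterPlus D bc z₀ i)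

/-- The iteration `z ↦ z - E(z) / W(z)` started at `z₀`. -/
def iterMinus (D : RealDiffExpr) (bc : BoundaryCondition D.n) (z₀ : ℝ) : ℕ → ℝ
  | 0 => z₀
  | i + 1 => iterMinus D bc z₀ i -
      evans D bc (iterMinus D bc z₀ i) / weight D bc (iterMinus D bc z₀ i)

end EvansNewton

end

/-!
The reason for the convergence is that `W(z) / |E(z)|` is the Hilbert–Schmidt norm of the resolvent
`(𝓛 - z)⁻¹`, and hence an upper bound, in fact a strict one, for the reciprocal of the distance
from `z` to the spectrum. No step of the iteration can therefore reach or jump over a point of the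
spectrum. The iterates cannot accumulate at a point where `E` does not vanish, since the steps are
bounded below near it.

In detail: variation of constants with the fundamental matrix solves the boundary value problem
for every square integrable right hand side where `E ≠ 0`, with `G` as `E` times the kernel of the
solution operator (`exists_isSolution`), and where `E = 0` there is a real eigenfunction
(`exists_eigenjet`). With the closed graph theorem this identifies the real spectrum with the zero
set of `E` (`mem_spectrum_iff`); self-adjointness enters only through the closedness of the graph.

If `E(z) ≠ 0 = E(z')` and `u` is an eigenfunction for `z'`, then `(𝓛 - z) u = (z' - z) u`, so that
`u` is an eigenfunction of the integral operator with kernel `G(·, ·, z)` and eigenvalue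
`τ = E(z) / (z' - z)`. With `N = ∫ u²`, the square of the kernel `G(x, y) - (τ / N) u(x) u(y)` has
integral `W² - τ²`. It is positive, because `G` is not of rank one
(`integral_greenKernel_sub_sq_pos`), so `|E(z)| / W(z) < |z' - z|` (`abs_evans_div_weight_lt`).

Finally `E` is continuous and `W` is bounded on bounded sets, by Grönwall's inequality for the
dependence of the fundamental matrix on `z`, and the convergence is a statement about real functions
(`strictMono_and_tendsto_of_step`).
-/

noncomputable section

namespace EvansNewton

-- Matrices carry the operator norm for the supremum norm on vectors and so form a normed ring.
open scoped Matrix.Norms.Operator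

/-! ### Linear systems of ordinary differential equations -/

section LinearODE

variable {ι : Type*} [Fintype ι] [DecidableEq ι]

/-- A linear system with continuous coefficients has a solution on the whole interval. The
Picard–Lindelöf theorem is applied to the vector field truncated outside a large cube, where it is
bounded; Grönwall's inequality shows that the solution never leaves the cube. -/
theorem exists_linear_ode_solution {L : ℝ} (hL : 0 ≤ L) {A : ℝ → Matrix ι ι ℝ}
    (hA : ContinuousOn A (Set.Icc 0 L)) (v₀ : ι → ℝ) :
    ∃ v : ℝ → ι → ℝ, v 0 = v₀ ∧
      ∀ x ∈ Set.Icc 0 L, HasDerivWithinAt v ((A x).mulVec (v x)) (Set.Icc 0 L) x := by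
  obtain ⟨C₀, hC₀⟩ := isCompact_Icc.exists_bound_of_continuousOn hA
  set C : NNReal := ⟨max C₀ 0, le_max_right _ _⟩ with hC
  have hAC : ∀ x ∈ Set.Icc 0 L, ‖A x‖ ≤ C := fun x hx => (hC₀ x hx).trans (le_max_left _ _)
  set R : NNReal := ⟨‖v₀‖ * Real.exp (C * L), by positivity⟩ with hR
  -- The truncation: `1`-Lipschitz, bounded by `R`, and the identity where `‖v‖ ≤ R`.
  let c : (ι → ℝ) → ι → ℝ := fun v i => max (-R) (min R (v i))
  have hcR : ∀ v, ‖c v‖ ≤ R := fun v => (pi_norm_le_iff_of_nonneg R.2).2 fun i => by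
    rw [Real.norm_eq_abs, abs_le]
    exact ⟨le_max_left _ _, max_le (by linarith [R.2]) (min_le_left _ _)⟩
  have hcd : ∀ v w, dist (c v) (c w) ≤ dist v w := fun v w =>
    (dist_pi_le_iff dist_nonneg).2 fun i => by
      refine le_trans ?_ (dist_le_pi_dist v w i)
      simp only [c, Real.dist_eq]
      refine (abs_max_sub_max_le_max _ _ _ _).trans ?_
      simp only [sub_self, abs_zero]
      refine max_le (abs_nonneg _) ((abs_min_sub_min_le_max _ _ _ _).trans ?_)
      simp
  have hc0 : c 0 = 0 := by
    ext i
    simp [c]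
  have hceq : ∀ v, ‖v‖ ≤ R → c v = v := fun v hv => by
    ext i
    have := abs_le.1 ((norm_le_pi_norm v i).trans hv)
    simp only [c]
    rw [min_eq_right this.2, max_eq_right this.1]
  have hPL : IsPicardLindelof (fun t v => (A t).mulVec (c v)) (tmin := 0) (tmax := L)
      ⟨0, le_rfl, hL⟩ v₀ (C * R * ⟨L, hL⟩) 0 (C * R) C := by
    refine ⟨fun t ht => (LipschitzWith.of_dist_le_mul fun v w => ?_).lipschitzOnWith,
      fun v _ => ?_, fun t ht v _ => ?_, ?_⟩
    · rw [dist_eq_norm, ← Matrix.mulVec_sub]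
      refine (Matrix.linfty_opNorm_mulVec _ _).trans ?_
      rw [← dist_eq_norm]
      exact mul_le_mul (hAC t ht) (hcd v w) dist_nonneg C.2
    · exact (continuous_id.matrix_mulVec continuous_const).comp_continuousOn hA
    · exact (Matrix.linfty_opNorm_mulVec _ _).trans
        (mul_le_mul (hAC t ht) (hcR v) (norm_nonneg _) C.2)
    · simp [hL]
      exact le_rfl
  obtain ⟨v, hv0, hv⟩ := hPL.exists_eq_forall_mem_Icc_hasDerivWithinAt₀
  have hvc : ∀ x ∈ Set.Icc 0 L, ‖v x‖ ≤ R := fun x hx => by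
    have h := norm_le_gronwallBound_of_norm_deriv_right_le (f := v)
      (f' := fun x => (A x).mulVec (c (v x))) (δ := ‖v₀‖) (K := C) (ε := 0)
      (fun x hx => (hv x hx).continuousWithinAt)
      (fun x hx => (hv x ⟨hx.1, hx.2.le⟩).mono_of_mem_nhdsWithin
        (mem_of_superset (Icc_mem_nhdsGE hx.2) (Set.Icc_subset_Icc_left hx.1)))
      (by simp only at hv0; rw [hv0])
      (fun x hx => by
        rw [add_zero]
        refine (Matrix.linfty_opNorm_mulVec _ _).trans
          (mul_le_mul (hAC x ⟨hx.1, hx.2.le⟩) ?_ (norm_nonneg _) C.2)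
        have := hcd (v x) 0
        rwa [hc0, dist_zero_right, dist_zero_right] at this) x hx
    rw [gronwallBound_ε0, sub_zero] at h
    refine h.trans ?_
    have : Real.exp (C * x) ≤ Real.exp (C * L) :=
      Real.exp_le_exp.2 (mul_le_mul_of_nonneg_left hx.2 C.2)
    exact mul_le_mul_of_nonneg_left this (norm_nonneg _)
  refine ⟨v, hv0, fun x hx => ?_⟩
  have h := hv x hx
  simp only [hceq _ (hvc x hx)] at h
  exact h

theorem exists_matrix_ode_solution {L : ℝ} (hL : 0 ≤ L) {A : ℝ → Matrix ι ι ℝ}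
    (hA : ContinuousOn A (Set.Icc 0 L)) :
    ∃ U : ℝ → Matrix ι ι ℝ, U 0 = 1 ∧ ∀ x ∈ Set.Icc 0 L, ∀ i j,
      HasDerivWithinAt (fun t => U t i j) ((A x * U x) i j) (Set.Icc 0 L) x := by
  choose v hv0 hv using fun j : ι => exists_linear_ode_solution hL hA (Pi.single j 1)
  refine ⟨fun x => Matrix.of fun i j => v j x i, ?_, fun x hx i j => ?_⟩
  · ext i j
    simp [hv0, Matrix.one_apply, Pi.single_apply]
  · exact hasDerivWithinAt_pi.1 (hv j x hx) i

/-- Differentiability of a matrix function may be checked entrywise. -/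
theorem hasDerivWithinAt_matrix {κ : Type*} [Fintype κ] {U : ℝ → Matrix κ κ ℝ} {U' : Matrix κ κ ℝ}
    {s : Set ℝ} {x : ℝ} :
    HasDerivWithinAt U U' s x ↔ ∀ i j, HasDerivWithinAt (fun t => U t i j) (U' i j) s x :=
  ⟨fun h i j => hasDerivWithinAt_pi.1 (hasDerivWithinAt_pi.1 h i) j,
    fun h => hasDerivWithinAt_pi.2 fun i => hasDerivWithinAt_pi.2 fun j => h i j⟩

/-- A matrix solution of `U' = A U` with initial value `1` has a left inverse, which solves the
adjoint system `V' = -V A`. -/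
theorem exists_adjoint_ode_solution {L : ℝ} (hL : 0 ≤ L) {A : ℝ → Matrix ι ι ℝ}
    (hA : ContinuousOn A (Set.Icc 0 L)) :
    ∃ V : ℝ → Matrix ι ι ℝ, V 0 = 1 ∧ ∀ x ∈ Set.Icc 0 L,
      HasDerivWithinAt V (-(V x * A x)) (Set.Icc 0 L) x := by
  obtain ⟨W, hW0, hW⟩ := exists_matrix_ode_solution hL (A := fun x => -(A x).transpose)
    ((continuous_id.matrix_transpose).comp_continuousOn hA).neg
  refine ⟨fun x => (W x).transpose, by simp [hW0], fun x hx => hasDerivWithinAt_matrix.2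
    fun i j => ?_⟩
  have h := hW x hx j i
  have e : (-(A x).transpose * W x) j i = (-((W x).transpose * A x)) i j := by
    rw [← Matrix.transpose_apply (-((W x).transpose * A x)) j i, Matrix.transpose_neg,
      Matrix.transpose_mul, Matrix.transpose_transpose, Matrix.neg_mul]
  rw [e] at h
  exact h

/-- A function with vanishing derivative on `[0, L]` is constant there. -/
theorem eq_of_hasDerivWithinAt_zero {E : Type*} [NormedAddCommGroup E] [NormedSpace ℝ E] {L : ℝ}
    {f : ℝ → E} (hf : ∀ x ∈ Set.Icc 0 L, HasDerivWithinAt f 0 (Set.Icc 0 L) x) {x : ℝ}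
    (hx : x ∈ Set.Icc 0 L) : f x = f 0 := by
  refine constant_of_has_deriv_right_zero (fun y hy => (hf y hy).continuousWithinAt)
    (fun y hy => (hf y ⟨hy.1, hy.2.le⟩).mono_of_mem_nhdsWithin
        (mem_of_superset (Icc_mem_nhdsGE hy.2) (Set.Icc_subset_Icc_left hy.1))) x hx

theorem adjoint_mul_eq_one {L : ℝ} {A U V : ℝ → Matrix ι ι ℝ} (hU0 : U 0 = 1) (hV0 : V 0 = 1)
    (hU : ∀ x ∈ Set.Icc 0 L, HasDerivWithinAt U (A x * U x) (Set.Icc 0 L) x)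
    (hV : ∀ x ∈ Set.Icc 0 L, HasDerivWithinAt V (-(V x * A x)) (Set.Icc 0 L) x)
    {x : ℝ} (hx : x ∈ Set.Icc 0 L) : V x * U x = 1 := by
  have h := eq_of_hasDerivWithinAt_zero (f := fun x => V x * U x) (fun y hy => by
    have e : -(V y * A y) * U y + V y * (A y * U y) = 0 := by
      rw [Matrix.neg_mul, Matrix.mul_assoc, neg_add_cancel]
    exact e ▸ (hV y hy).mul (hU y hy)) hx
  simpa [hU0, hV0] using h

/-- Grönwall's inequality: if the coefficients of two linear systems differ by at most `ε` on
`[0, L]`, then their solutions with the same initial value differ by at most a constant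
times `ε`. -/
theorem norm_sub_le_of_linear_ode {L : ℝ} {A B U V : ℝ → Matrix ι ι ℝ} {K C ε : ℝ}
    (hK : 1 ≤ K) (h0 : U 0 = V 0)
    (hU : ∀ x ∈ Set.Icc 0 L, HasDerivWithinAt U (A x * U x) (Set.Icc 0 L) x)
    (hV : ∀ x ∈ Set.Icc 0 L, HasDerivWithinAt V (B x * V x) (Set.Icc 0 L) x)
    (hA : ∀ x ∈ Set.Icc 0 L, ‖A x‖ ≤ K) (hAB : ∀ x ∈ Set.Icc 0 L, ‖A x - B x‖ ≤ ε)
    (hVC : ∀ x ∈ Set.Icc 0 L, ‖V x‖ ≤ C) (hε : 0 ≤ ε) :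
    ∀ x ∈ Set.Icc 0 L, ‖U x - V x‖ ≤ ε * (C * Real.exp (K * L)) := by
  intro x hx
  have hC : 0 ≤ C := (norm_nonneg _).trans (hVC x hx)
  have h := norm_le_gronwallBound_of_norm_deriv_right_le (f := fun x => U x - V x)
      (f' := fun x => A x * U x - B x * V x) (δ := 0) (K := K) (ε := ε * C) (a := 0) (b := L)
      (fun x hx => (hU x hx).continuousWithinAt.sub (hV x hx).continuousWithinAt)
      (fun x hx => ((hU x ⟨hx.1, hx.2.le⟩).sub (hV x ⟨hx.1, hx.2.le⟩)).mono_of_mem_nhdsWithin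
        (mem_of_superset (Icc_mem_nhdsGE hx.2) (Set.Icc_subset_Icc_left hx.1)))
      (by simp [h0])
      (fun y hy => by
        have hy' : y ∈ Set.Icc 0 L := ⟨hy.1, hy.2.le⟩
        have e : A y * U y - B y * V y = A y * (U y - V y) + (A y - B y) * V y := by
          noncomm_ring
        rw [e]
        refine (norm_add_le _ _).trans (add_le_add ((norm_mul_le _ _).trans ?_)
          ((norm_mul_le _ _).trans ?_))
        · exact mul_le_mul_of_nonneg_right (hA y hy') (norm_nonneg _)
        · exact mul_le_mul (hAB y hy') (hVC y hy') (norm_nonneg _) hε) x hx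
  refine h.trans ?_
  rw [gronwallBound_of_K_ne_0 (by positivity)]
  have h1 : Real.exp (K * (x - 0)) ≤ Real.exp (K * L) :=
    Real.exp_le_exp.2 (by rw [sub_zero]; exact mul_le_mul_of_nonneg_left hx.2 (by linarith))
  have h2 : ε * C / K ≤ ε * C := div_le_self (by positivity) hK
  have h3 : ε * C / K * (Real.exp (K * (x - 0)) - 1) ≤ ε * C * (Real.exp (K * L)) := by
    refine mul_le_mul h2 (by linarith) ?_ (by positivity)
    linarith [Real.one_le_exp (x := K * (x - 0))
      (by rw [sub_zero]; exact mul_nonneg (by linarith) hx.1)]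
  linarith

end LinearODE

/-! ### The fundamental matrix of the differential expression -/

variable (D : RealDiffExpr)

theorem RealDiffExpr.continuousOn (j : Fin (D.n + 1)) : ContinuousOn (D.a j) (Set.Icc 0 D.L) :=
  (D.smooth j).continuousOn

/-- The matrix through which the spectral parameter enters the system. -/
def parameterMatrix (x : ℝ) : Matrix (Fin D.n) (Fin D.n) ℝ :=
  Matrix.of fun i j =>
    if (i : ℕ) + 1 < D.n then 0 else (if (j : ℕ) = 0 then 1 else 0) / D.a (Fin.last D.n) x

theorem companion_sub_companion (z z' x : ℝ) :
    companion D z x - companion D z' x = (z - z') • parameterMatrix D x := by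
  ext i j
  simp only [companion, parameterMatrix, Matrix.sub_apply, Matrix.smul_apply, Matrix.of_apply,
    smul_eq_mul]
  split_ifs <;> ring

theorem continuousOn_parameterMatrix : ContinuousOn (parameterMatrix D) (Set.Icc 0 D.L) := by
  refine continuousOn_pi.2 fun i => continuousOn_pi.2 fun j => ?_
  simp only [parameterMatrix, Matrix.of_apply]
  split_ifs
  · exact continuousOn_const
  · exact continuousOn_const.div (D.continuousOn _) D.lead_ne_zero
  · exact continuousOn_const.div (D.continuousOn _) D.lead_ne_zero

theorem continuousOn_companion (z : ℝ) : ContinuousOn (companion D z) (Set.Icc 0 D.L) := by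
  refine continuousOn_pi.2 fun i => continuousOn_pi.2 fun j => ?_
  simp only [companion, Matrix.of_apply]
  split_ifs
  · exact continuousOn_const
  · exact continuousOn_const
  · exact (continuousOn_const.sub (D.continuousOn _)).div (D.continuousOn _) D.lead_ne_zero
  · exact (continuousOn_const.sub (D.continuousOn _)).div (D.continuousOn _) D.lead_ne_zero

theorem isFundamentalMatrix_fundamental (z : ℝ) :
    IsFundamentalMatrix D z (fundamental D z) :=
  Classical.epsilon_spec (exists_matrix_ode_solution D.L_pos.le (continuousOn_companion D z))

theorem fundamental_zero (z : ℝ) : fundamental D z 0 = 1 := (isFundamentalMatrix_fundamental D z).1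

theorem hasDerivWithinAt_fundamental (z : ℝ) {x : ℝ} (hx : x ∈ Set.Icc 0 D.L) :
    HasDerivWithinAt (fundamental D z) (companion D z x * fundamental D z x) (Set.Icc 0 D.L) x :=
  hasDerivWithinAt_matrix.2 ((isFundamentalMatrix_fundamental D z).2 x hx)

theorem continuousOn_fundamental (z : ℝ) :
    ContinuousOn (fundamental D z) (Set.Icc 0 D.L) :=
  fun _ hx => (hasDerivWithinAt_fundamental D z hx).continuousWithinAt

theorem isUnit_det_fundamental (z : ℝ) {x : ℝ} (hx : x ∈ Set.Icc 0 D.L) :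
    IsUnit (fundamental D z x).det := by
  obtain ⟨V, hV0, hV⟩ := exists_adjoint_ode_solution D.L_pos.le (continuousOn_companion D z)
  exact Matrix.isUnit_det_of_left_inverse (adjoint_mul_eq_one (fundamental_zero D z) hV0
    (fun x hx => hasDerivWithinAt_fundamental D z hx) hV hx)

theorem hasDerivWithinAt_fundamental_inv (z : ℝ) {x : ℝ} (hx : x ∈ Set.Icc 0 D.L) :
    HasDerivWithinAt (fun x => (fundamental D z x)⁻¹)
      (-((fundamental D z x)⁻¹ * companion D z x)) (Set.Icc 0 D.L) x := by
  obtain ⟨V, hV0, hV⟩ := exists_adjoint_ode_solution D.L_pos.le (continuousOn_companion D z)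
  have h : ∀ x ∈ Set.Icc 0 D.L, (fundamental D z x)⁻¹ = V x := fun x hx =>
    Matrix.inv_eq_left_inv (adjoint_mul_eq_one (fundamental_zero D z) hV0
      (fun x hx => hasDerivWithinAt_fundamental D z hx) hV hx)
  rw [h x hx]
  exact (hV x hx).congr h (h x hx)

/-- The fundamental matrix is jointly continuous in the spectral parameter and the variable. -/
theorem continuousOn_uncurry_fundamental :
    ContinuousOn (fun p : ℝ × ℝ => fundamental D p.1 p.2) (Set.univ ×ˢ Set.Icc 0 D.L) := by
  rintro ⟨z, x⟩ ⟨-, hx⟩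
  obtain ⟨K₀, hK₀⟩ := isCompact_Icc.exists_bound_of_continuousOn (continuousOn_companion D z)
  obtain ⟨Q, hQ⟩ := isCompact_Icc.exists_bound_of_continuousOn (continuousOn_parameterMatrix D)
  obtain ⟨C, hC⟩ := isCompact_Icc.exists_bound_of_continuousOn (continuousOn_fundamental D z)
  have hQ0 : 0 ≤ Q := (norm_nonneg _).trans (hQ x hx)
  have hK0 : 0 ≤ K₀ := (norm_nonneg _).trans (hK₀ x hx)
  -- For `|w - z| ≤ 1` the coefficients are bounded by `K₀ + Q`, independently of `w`.
  have key : ∀ w, |w - z| ≤ 1 → ∀ y ∈ Set.Icc 0 D.L, ‖fundamental D w y - fundamental D z y‖ ≤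
      |w - z| * Q * (C * Real.exp ((1 + (K₀ + Q)) * D.L)) := fun w hw => by
    have hd : ∀ y ∈ Set.Icc 0 D.L, ‖companion D w y - companion D z y‖ ≤ |w - z| * Q :=
      fun y hy => by
        rw [companion_sub_companion, norm_smul, Real.norm_eq_abs]
        exact mul_le_mul_of_nonneg_left (hQ y hy) (abs_nonneg _)
    refine norm_sub_le_of_linear_ode (A := companion D w) (B := companion D z) (by linarith)
      (by rw [fundamental_zero, fundamental_zero]) (fun y hy => hasDerivWithinAt_fundamental D w hy)
      (fun y hy => hasDerivWithinAt_fundamental D z hy) (fun y hy => ?_) hd hC (by positivity)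
    have h1 := norm_add_le (companion D w y - companion D z y) (companion D z y)
    rw [sub_add_cancel] at h1
    have h2 : |w - z| * Q ≤ 1 * Q := mul_le_mul_of_nonneg_right hw hQ0
    linarith [hd y hy, hK₀ y hy]
  refine tendsto_iff_norm_sub_tendsto_zero.2 ?_
  have h1 : Tendsto (fun p : ℝ × ℝ => |p.1 - z| * Q * (C * Real.exp ((1 + (K₀ + Q)) * D.L)))
      (𝓝[Set.univ ×ˢ Set.Icc 0 D.L] (z, x)) (𝓝 0) := by
    have : Continuous fun p : ℝ × ℝ => |p.1 - z| * Q * (C * Real.exp ((1 + (K₀ + Q)) * D.L)) := by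
      fun_prop
    simpa using (this.tendsto (z, x)).mono_left nhdsWithin_le_nhds
  have h2 : Tendsto (fun p : ℝ × ℝ => ‖fundamental D z p.2 - fundamental D z x‖)
      (𝓝[Set.univ ×ˢ Set.Icc 0 D.L] (z, x)) (𝓝 0) := by
    refine tendsto_iff_norm_sub_tendsto_zero.1 ?_
    refine (continuousOn_fundamental D z x hx).tendsto.comp ?_
    exact tendsto_nhdsWithin_of_tendsto_nhds_of_eventually_within _
      ((continuous_snd.tendsto (z, x)).mono_left nhdsWithin_le_nhds)
      (eventually_nhdsWithin_of_forall fun p hp => hp.2)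
  have h3 : ∀ᶠ p : ℝ × ℝ in 𝓝[Set.univ ×ˢ Set.Icc 0 D.L] (z, x),
      |p.1 - z| ≤ 1 ∧ p.2 ∈ Set.Icc 0 D.L := by
    refine Eventually.and ?_ (eventually_nhdsWithin_of_forall fun p hp => hp.2)
    have : Tendsto (fun p : ℝ × ℝ => |p.1 - z|) (𝓝[Set.univ ×ˢ Set.Icc 0 D.L] (z, x)) (𝓝 0) := by
      have h : Continuous fun p : ℝ × ℝ => |p.1 - z| := by fun_prop
      simpa using (h.tendsto (z, x)).mono_left nhdsWithin_le_nhds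
    exact this.eventually (ge_mem_nhds one_pos)
  refine squeeze_zero' (Eventually.of_forall fun _ => norm_nonneg _) (h3.mono fun p hp => ?_)
    (by simpa using h1.add h2)
  have := norm_add_le (fundamental D p.1 p.2 - fundamental D z p.2)
    (fundamental D z p.2 - fundamental D z x)
  rw [sub_add_sub_cancel] at this
  exact this.trans (add_le_add (key _ hp.1 _ hp.2) le_rfl)

theorem continuous_monodromy : Continuous (monodromy D) := by
  have h := (continuousOn_uncurry_fundamental D).comp (f := fun z : ℝ => (z, D.L)) (s := Set.univ)
    (by fun_prop) (fun z _ => ⟨trivial, D.L_pos.le, le_rfl⟩)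
  exact continuousOn_univ.1 h

theorem continuous_evans (bc : BoundaryCondition D.n) : Continuous (evans D bc) := by
  have h := continuous_monodromy D
  cases bc with
  | separated b => exact ((continuous_const.matrix_mul h).matrix_mul continuous_const).matrix_det
  | periodic => exact (h.sub continuous_const).matrix_det

theorem continuous_projector (bc : BoundaryCondition D.n) : Continuous (projector D bc) := by
  have h := continuous_monodromy D
  cases bc with
  | separated b =>
    exact ((continuous_const.matrix_mul ((continuous_const.matrix_mul h).matrix_mul
      continuous_const).matrix_adjugate).matrix_mul continuous_const).matrix_mul h
  | periodic => exact (h.sub continuous_const).matrix_adjugate.matrix_mul h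

theorem continuousOn_uncurry_fundamental_inv :
    ContinuousOn (fun p : ℝ × ℝ => (fundamental D p.1 p.2)⁻¹) (Set.univ ×ˢ Set.Icc 0 D.L) := by
  have h := continuousOn_uncurry_fundamental D
  simp only [Matrix.inv_def, Ring.inverse_eq_inv']
  refine ContinuousOn.smul (ContinuousOn.inv₀ (continuous_id.matrix_det.comp_continuousOn h)
    fun p hp => (isUnit_det_fundamental D p.1 hp.2).ne_zero)
    (continuous_id.matrix_adjugate.comp_continuousOn h)

/-! ### The boundary value problem for the fundamental matrix -/

section Matrices

variable {l m n : Type*}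

/-- A real matrix, regarded as a complex matrix. -/
abbrev complexify (A : Matrix m n ℝ) : Matrix m n ℂ := A.map (fun r => (r : ℂ))

theorem complexify_mul [Fintype m] (A : Matrix l m ℝ) (B : Matrix m n ℝ) :
    complexify (A * B) = complexify A * complexify B :=
  Matrix.map_mul (f := Complex.ofRealHom)

theorem complexify_one [DecidableEq n] : complexify (1 : Matrix n n ℝ) = 1 :=
  Matrix.map_one _ Complex.ofReal_zero Complex.ofReal_one

theorem complexify_smul_one [DecidableEq n] (r : ℝ) :
    complexify (r • (1 : Matrix n n ℝ)) = (r : ℂ) • 1 := by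
  ext i j
  by_cases h : i = j <;> simp [h]

theorem complexify_mulVec_ofReal [Fintype n] (A : Matrix m n ℝ) (c : n → ℝ) :
    (complexify A).mulVec (fun j => (c j : ℂ)) = fun i => ((A.mulVec c i : ℝ) : ℂ) := by
  ext i
  simp [Matrix.mulVec, dotProduct]

theorem complexify_mulVec_re [Fintype n] (A : Matrix m n ℝ) (c : n → ℂ) :
    (fun i => ((complexify A).mulVec c i).re) = A.mulVec fun j => (c j).re := by
  ext i
  simp [Matrix.mulVec, dotProduct]

theorem complexify_mulVec_im [Fintype n] (A : Matrix m n ℝ) (c : n → ℂ) :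
    (fun i => ((complexify A).mulVec c i).im) = A.mulVec fun j => (c j).im := by
  ext i
  simp [Matrix.mulVec, dotProduct]

end Matrices

/-- The columns of `NL` span the null space of `BL`. -/
theorem SeparatedBC.exists_eq_NL_mulVec {n : ℕ} (b : SeparatedBC n) {c : Fin n → ℝ}
    (hc : b.BL.mulVec c = 0) : ∃ d, b.NL.mulVec d = c := by
  have hle : LinearMap.range b.NL.mulVecLin ≤ LinearMap.ker b.BL.mulVecLin := by
    rintro _ ⟨d, rfl⟩
    rw [LinearMap.mem_ker, Matrix.mulVecLin_apply, Matrix.mulVecLin_apply, Matrix.mulVec_mulVec,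
      b.BL_mul_NL, Matrix.zero_mulVec]
  have h1 : Module.finrank ℝ (LinearMap.range b.NL.mulVecLin) = b.m := by
    rw [LinearMap.finrank_range_of_inj (Matrix.mulVec_injective_iff.2 b.NL_indep)]
    simp
  have h2 : Module.finrank ℝ (LinearMap.range b.BL.mulVecLin) = b.k := by
    have := b.BL_full.rank_matrix
    simpa [Matrix.rank] using this
  have h3 := LinearMap.finrank_range_add_finrank_ker b.BL.mulVecLin
  rw [h2, Module.finrank_fin_fun] at h3
  have h4 := Submodule.eq_of_le_of_finrank_eq hle (by have := b.add_eq; omega)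
  have h5 : c ∈ LinearMap.range b.NL.mulVecLin := by
    rw [h4]
    exact hc
  exact h5

section Boundary

variable (D : RealDiffExpr) (bc : BoundaryCondition D.n) (z : ℝ)

/-- Where the Evans function vanishes, some nonzero initial vector satisfies the boundary
conditions. -/
theorem exists_initial_of_evans_eq_zero (h : evans D bc z = 0) :
    ∃ c : Fin D.n → ℝ, c ≠ 0 ∧ bc.Holds (fun j => (c j : ℂ))
      ((complexify (monodromy D z)).mulVec fun j => (c j : ℂ)) := by
  cases bc with
  | separated b =>
    obtain ⟨d, hd0, hd⟩ := Matrix.exists_mulVec_eq_zero_iff.2 h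
    refine ⟨b.NL.mulVec d, fun h0 => hd0 (Matrix.mulVec_injective_iff.2 b.NL_indep
      (by rw [h0, Matrix.mulVec_zero])), ?_, ?_⟩
    · change (complexify b.BL).mulVec _ = 0
      rw [complexify_mulVec_ofReal, Matrix.mulVec_mulVec, b.BL_mul_NL]
      ext i
      simp
    · change (complexify b.BR).mulVec _ = 0
      rw [complexify_mulVec_ofReal, complexify_mulVec_ofReal, Matrix.mulVec_mulVec,
        Matrix.mulVec_mulVec, hd]
      ext i
      simp
  | periodic =>
    obtain ⟨d, hd0, hd⟩ := Matrix.exists_mulVec_eq_zero_iff.2 h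
    refine ⟨d, hd0, ?_⟩
    rw [Matrix.sub_mulVec, Matrix.one_mulVec, sub_eq_zero] at hd
    change (fun j => (d j : ℂ)) = _
    rw [complexify_mulVec_ofReal, hd]

/-- Where the Evans function does not vanish, only the zero initial vector satisfies the boundary
conditions. -/
theorem initial_eq_zero_of_evans_ne_zero (h : evans D bc z ≠ 0) {c : Fin D.n → ℂ}
    (hc : bc.Holds c ((complexify (monodromy D z)).mulVec c)) : c = 0 := by
  cases bc with
  | separated b =>
    have key : ∀ c : Fin D.n → ℝ, b.BL.mulVec c = 0 →
        b.BR.mulVec ((monodromy D z).mulVec c) = 0 → c = 0 := fun c h1 h2 => by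
      obtain ⟨d, rfl⟩ := b.exists_eq_NL_mulVec h1
      rw [Matrix.mulVec_mulVec, Matrix.mulVec_mulVec] at h2
      rw [Matrix.eq_zero_of_mulVec_eq_zero h h2, Matrix.mulVec_zero]
    obtain ⟨h1, h2⟩ := hc
    have hr := key (fun j => (c j).re)
      (by rw [← complexify_mulVec_re, complexify, h1]; rfl)
      (by rw [← complexify_mulVec_re, ← complexify_mulVec_re, complexify, h2]; rfl)
    have hi := key (fun j => (c j).im)
      (by rw [← complexify_mulVec_im, complexify, h1]; rfl)
      (by rw [← complexify_mulVec_im, ← complexify_mulVec_im, complexify, h2]; rfl)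
    ext j
    exact Complex.ext (congrFun hr j) (congrFun hi j)
  | periodic =>
    have key : ∀ c : Fin D.n → ℝ, c = (monodromy D z).mulVec c → c = 0 := fun c h1 =>
      Matrix.eq_zero_of_mulVec_eq_zero h
        (by rw [Matrix.sub_mulVec, Matrix.one_mulVec, ← h1, sub_self])
    have h1 : c = (complexify (monodromy D z)).mulVec c := hc
    have hr := key (fun j => (c j).re) (by rw [← complexify_mulVec_re, ← h1])
    have hi := key (fun j => (c j).im) (by rw [← complexify_mulVec_im, ← h1])
    ext j
    exact Complex.ext (congrFun hr j) (congrFun hi j)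

/-- The initial vector `-E⁻¹ P r` corrects the accumulated forcing `r` so that the boundary
conditions hold. -/
theorem holds_neg_projector_mulVec (h : evans D bc z ≠ 0) (r : Fin D.n → ℂ) :
    bc.Holds (-((evans D bc z : ℂ)⁻¹ • (complexify (projector D bc z)).mulVec r))
      ((complexify (monodromy D z)).mulVec
        (-((evans D bc z : ℂ)⁻¹ • (complexify (projector D bc z)).mulVec r) + r)) := by
  have hE : (evans D bc z : ℂ) ≠ 0 := by exact_mod_cast h
  cases bc with
  | separated b =>
    have e1 : b.BL * projector D (.separated b) z = 0 := by
      simp only [projector, ← Matrix.mul_assoc, b.BL_mul_NL, Matrix.zero_mul]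
    have e2 : b.BR * monodromy D z * projector D (.separated b) z =
        evans D (.separated b) z • (1 : Matrix (Fin b.m) (Fin b.m) ℝ) * (b.BR * monodromy D z) := by
      have := Matrix.mul_adjugate (b.BR * monodromy D z * b.NL)
      simp only [projector, evans, ← Matrix.mul_assoc, ← this]
    refine ⟨?_, ?_⟩
    · change (complexify b.BL).mulVec _ = 0
      rw [Matrix.mulVec_neg, Matrix.mulVec_smul, Matrix.mulVec_mulVec, ← complexify_mul, e1]
      ext i
      simp
    · change (complexify b.BR).mulVec _ = 0
      rw [Matrix.mulVec_mulVec, ← complexify_mul, Matrix.mulVec_add, Matrix.mulVec_neg,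
        Matrix.mulVec_smul, Matrix.mulVec_mulVec, ← complexify_mul, e2, complexify_mul,
        complexify_smul_one, Matrix.smul_mul, Matrix.one_mul, Matrix.smul_mulVec, smul_smul,
        inv_mul_cancel₀ hE, one_smul, neg_add_cancel]
  | periodic =>
    have e2 : (monodromy D z - 1) * projector D .periodic z =
        evans D .periodic z • (1 : Matrix (Fin D.n) (Fin D.n) ℝ) * monodromy D z := by
      have := Matrix.mul_adjugate (monodromy D z - 1)
      simp only [projector, evans, ← Matrix.mul_assoc, ← this]
    rw [Matrix.sub_mul, Matrix.one_mul, sub_eq_iff_eq_add] at e2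
    change _ = _
    rw [Matrix.mulVec_add, Matrix.mulVec_neg, Matrix.mulVec_smul, Matrix.mulVec_mulVec,
      ← complexify_mul, e2]
    have e3 : complexify (evans D .periodic z • (1 : Matrix (Fin D.n) (Fin D.n) ℝ) * monodromy D z +
        projector D .periodic z) = (evans D .periodic z : ℂ) • complexify (monodromy D z) +
          complexify (projector D .periodic z) := by
      ext i j
      simp
    rw [e3, Matrix.add_mulVec, Matrix.smul_mulVec, smul_add, smul_smul, inv_mul_cancel₀ hE,
      one_smul]
    abel

end Boundary

/-! ### Sobolev jets -/

/-- An interval integrable function all of whose primitives on `[0, L]` vanish is zero. -/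
theorem ae_eq_zero_of_integral_eq_zero {L : ℝ} (hL : 0 ≤ L) {g : ℝ → ℂ}
    (hg : IntervalIntegrable g volume 0 L)
    (h : ∀ x ∈ Set.Icc 0 L, ∫ t in (0 : ℝ)..x, g t = 0) :
    g =ᵐ[volume.restrict (Set.Icc 0 L)] 0 := by
  rw [← Measure.restrict_congr_set Ioo_ae_eq_Icc]
  refine (ae_restrict_iff' measurableSet_Ioo).2 ?_
  filter_upwards [hg.ae_hasDerivAt_integral] with x hx hx'
  have hd := hx (Set.uIcc_of_le hL ▸ Set.Ioo_subset_Icc_self hx') 0 Set.left_mem_uIcc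
  refine hd.unique ((hasDerivAt_const x (0 : ℂ)).congr_of_eventuallyEq ?_)
  filter_upwards [Ioo_mem_nhds hx'.1 hx'.2] with y hy using h y (Set.Ioo_subset_Icc_self hy)

/-- The product rule for a continuously differentiable and an absolutely continuous function. -/
theorem mul_primitive_eq_integral_real {L : ℝ} (hL : 0 < L) {p p' g : ℝ → ℝ}
    (hp : ∀ x ∈ Set.Icc 0 L, HasDerivWithinAt p (p' x) (Set.Icc 0 L) x)
    (hp' : ContinuousOn p' (Set.Icc 0 L)) (hg : IntervalIntegrable g volume 0 L) {x : ℝ}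
    (hx : x ∈ Set.Icc 0 L) :
    p x * ∫ t in (0 : ℝ)..x, g t =
      ∫ t in (0 : ℝ)..x, (p' t * (∫ s in (0 : ℝ)..t, g s) + p t * g t) := by
  have hx0 : Set.uIcc 0 x = Set.Icc 0 x := Set.uIcc_of_le hx.1
  have hsub : Set.Icc 0 x ⊆ Set.Icc 0 L := Set.Icc_subset_Icc_right hx.2
  have hg' : IntervalIntegrable g volume 0 x :=
    hg.mono_set (by rw [hx0, Set.uIcc_of_le hL.le]; exact hsub)
  have hpac : AbsolutelyContinuousOnInterval p 0 x := by
    have h1 : ContDiffOn ℝ 1 p (Set.Icc 0 L) := by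
      rw [contDiffOn_one_iff_derivWithin (uniqueDiffOn_Icc hL)]
      exact ⟨fun y hy => (hp y hy).differentiableWithinAt, hp'.congr fun y hy =>
        (hp y hy).derivWithin (uniqueDiffOn_Icc hL y hy)⟩
    exact (h1.mono (hx0 ▸ hsub)).absolutelyContinuousOnInterval
  have hqac := hg'.absolutelyContinuousOnInterval_intervalIntegral Set.left_mem_uIcc
  have h := hpac.integral_deriv_mul_eq_sub hqac
  simp only [intervalIntegral.integral_same, mul_zero, sub_zero] at h
  rw [← h]
  refine intervalIntegral.integral_congr_ae ?_
  have hne : ∀ᵐ t : ℝ, t ≠ x := by simp [ae_iff]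
  filter_upwards [hg'.ae_hasDerivAt_integral, hne] with t ht htx ht'
  rw [Set.uIoc_of_le hx.1] at ht'
  have htL : t < L := lt_of_lt_of_le (lt_of_le_of_ne ht'.2 htx) hx.2
  rw [(ht (hx0 ▸ Set.Ioc_subset_Icc_self ht') 0 Set.left_mem_uIcc).deriv,
    ((hp t ⟨ht'.1.le, htL.le⟩).hasDerivAt (Icc_mem_nhds ht'.1 htL)).deriv]

theorem continuousOn_primitive {L : ℝ} (hL : 0 ≤ L) {g : ℝ → ℂ}
    (hg : IntervalIntegrable g volume 0 L) :
    ContinuousOn (fun x => ∫ t in (0 : ℝ)..x, g t) (Set.Icc 0 L) := by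
  have := intervalIntegral.continuousOn_primitive_interval' hg Set.left_mem_uIcc
  rwa [Set.uIcc_of_le hL] at this

theorem mul_primitive_eq_integral {L : ℝ} (hL : 0 < L) {p p' : ℝ → ℝ} {g : ℝ → ℂ}
    (hp : ∀ x ∈ Set.Icc 0 L, HasDerivWithinAt p (p' x) (Set.Icc 0 L) x)
    (hp' : ContinuousOn p' (Set.Icc 0 L)) (hg : IntervalIntegrable g volume 0 L) {x : ℝ}
    (hx : x ∈ Set.Icc 0 L) :
    IntervalIntegrable (fun t => (p' t : ℂ) * (∫ s in (0 : ℝ)..t, g s) + p t * g t) volume 0 L ∧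
    (p x : ℂ) * ∫ t in (0 : ℝ)..x, g t =
      ∫ t in (0 : ℝ)..x, ((p' t : ℂ) * (∫ s in (0 : ℝ)..t, g s) + p t * g t) := by
  have hpc : ContinuousOn p (Set.Icc 0 L) := fun y hy => (hp y hy).continuousWithinAt
  have hint : IntervalIntegrable (fun t => (p' t : ℂ) * (∫ s in (0 : ℝ)..t, g s) + p t * g t)
      volume 0 L := by
    refine IntervalIntegrable.add (ContinuousOn.intervalIntegrable ?_)
      (hg.continuousOn_mul ?_)
    · rw [Set.uIcc_of_le hL.le]
      exact (Complex.continuous_ofReal.comp_continuousOn hp').mul (continuousOn_primitive hL.le hg)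
    · rw [Set.uIcc_of_le hL.le]
      exact Complex.continuous_ofReal.comp_continuousOn hpc
  have hsub : ∀ y ∈ Set.Icc 0 L, Set.uIcc 0 y ⊆ Set.uIcc 0 L := fun y hy => by
    rw [Set.uIcc_of_le hL.le, Set.uIcc_of_le hy.1]
    exact Set.Icc_subset_Icc_right hy.2
  have hre : IntervalIntegrable (fun t => (g t).re) volume 0 L :=
    ⟨hg.1.re, hg.2.re⟩
  have him : IntervalIntegrable (fun t => (g t).im) volume 0 L :=
    ⟨hg.1.im, hg.2.im⟩
  have ire : ∀ y ∈ Set.Icc 0 L, ∀ {h : ℝ → ℂ}, IntervalIntegrable h volume 0 L →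
      (∫ t in (0 : ℝ)..y, h t).re = ∫ t in (0 : ℝ)..y, (h t).re := fun y hy h hh =>
    (Complex.reCLM.intervalIntegral_comp_comm (hh.mono_set (hsub y hy))).symm
  have iim : ∀ y ∈ Set.Icc 0 L, ∀ {h : ℝ → ℂ}, IntervalIntegrable h volume 0 L →
      (∫ t in (0 : ℝ)..y, h t).im = ∫ t in (0 : ℝ)..y, (h t).im := fun y hy h hh =>
    (Complex.imCLM.intervalIntegral_comp_comm (hh.mono_set (hsub y hy))).symm
  refine ⟨hint, Complex.ext ?_ ?_⟩
  · rw [Complex.re_ofReal_mul, ire x hx hg, ire x hx hint,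
      mul_primitive_eq_integral_real hL hp hp' hre hx]
    refine intervalIntegral.integral_congr fun t ht => ?_
    rw [Set.uIcc_of_le hx.1] at ht
    simp only [Complex.add_re, Complex.re_ofReal_mul]
    rw [ire t ⟨ht.1, ht.2.trans hx.2⟩ hg]
  · rw [Complex.im_ofReal_mul, iim x hx hg, iim x hx hint,
      mul_primitive_eq_integral_real hL hp hp' him hx]
    refine intervalIntegral.integral_congr fun t ht => ?_
    rw [Set.uIcc_of_le hx.1] at ht
    simp only [Complex.add_im, Complex.im_ofReal_mul]
    rw [iim t ⟨ht.1, ht.2.trans hx.2⟩ hg]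

/-- The product rule `(P q)' = P' q + P q'`, for a continuously differentiable matrix `P` and an
absolutely continuous vector `q` with derivative `g`. -/
theorem matrix_mulVec_eq_integral {ι : Type*} [Fintype ι] {L : ℝ} (hL : 0 < L)
    {P P' : ℝ → Matrix ι ι ℝ} {q g : ι → ℝ → ℂ}
    (hP : ∀ x ∈ Set.Icc 0 L, ∀ i j, HasDerivWithinAt (fun t => P t i j) (P' x i j) (Set.Icc 0 L) x)
    (hP' : ContinuousOn P' (Set.Icc 0 L)) (hg : ∀ j, IntervalIntegrable (g j) volume 0 L)
    (hq : ∀ j, ∀ x ∈ Set.Icc 0 L, q j x = q j 0 + ∫ t in (0 : ℝ)..x, g j t) (i : ι) :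
    IntervalIntegrable (fun t => ∑ j, ((P' t i j : ℂ) * q j t + P t i j * g j t)) volume 0 L ∧
    ∀ x ∈ Set.Icc 0 L, ∑ j, (P x i j : ℂ) * q j x = ∑ j, (P 0 i j : ℂ) * q j 0 +
      ∫ t in (0 : ℝ)..x, ∑ j, ((P' t i j : ℂ) * q j t + P t i j * g j t) := by
  have h0 : (0 : ℝ) ∈ Set.Icc 0 L := ⟨le_rfl, hL.le⟩
  have hP'c : ∀ j, ContinuousOn (fun t => P' t i j) (Set.Icc 0 L) := fun j =>
    continuousOn_pi.1 (continuousOn_pi.1 hP' i) j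
  have main : ∀ j, IntervalIntegrable (fun t => (P' t i j : ℂ) * q j t + P t i j * g j t)
      volume 0 L ∧ ∀ x ∈ Set.Icc 0 L, (P x i j : ℂ) * q j x = (P 0 i j : ℂ) * q j 0 +
        ∫ t in (0 : ℝ)..x, ((P' t i j : ℂ) * q j t + P t i j * g j t) := fun j => by
    have hp : ∀ x ∈ Set.Icc 0 L, HasDerivWithinAt (fun t => P t i j) (P' x i j) (Set.Icc 0 L) x :=
      fun x hx => hP x hx i j
    have hc : IntervalIntegrable (fun t => (P' t i j : ℂ) * q j 0) volume 0 L := by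
      refine ContinuousOn.intervalIntegrable ?_
      rw [Set.uIcc_of_le hL.le]
      exact (Complex.continuous_ofReal.comp_continuousOn (hP'c j)).mul continuousOn_const
    have hs := (mul_primitive_eq_integral hL hp (hP'c j) (hg j) h0).1
    have hsplit : ∀ t ∈ Set.Icc 0 L, (P' t i j : ℂ) * q j t + P t i j * g j t =
        (P' t i j : ℂ) * q j 0 +
          ((P' t i j : ℂ) * (∫ s in (0 : ℝ)..t, g j s) + P t i j * g j t) := fun t ht => by
      rw [hq j t ht]
      ring
    refine ⟨(hc.add hs).congr fun t ht => ?_, fun x hx => ?_⟩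
    · rw [Set.uIoc_of_le hL.le] at ht
      exact (hsplit t (Set.Ioc_subset_Icc_self ht)).symm
    · have hsub : Set.uIcc 0 x ⊆ Set.uIcc 0 L := by
        rw [Set.uIcc_of_le hL.le, Set.uIcc_of_le hx.1]
        exact Set.Icc_subset_Icc_right hx.2
      rw [intervalIntegral.integral_congr (g := fun t => (P' t i j : ℂ) * q j 0 +
          ((P' t i j : ℂ) * (∫ s in (0 : ℝ)..t, g j s) + P t i j * g j t))
          (fun t ht => hsplit t (by
            have := hsub ht
            rwa [Set.uIcc_of_le hL.le] at this)),
        intervalIntegral.integral_add (hc.mono_set hsub) (hs.mono_set hsub),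
        ← (mul_primitive_eq_integral hL hp (hP'c j) (hg j) hx).2,
        intervalIntegral.integral_mul_const, hq j x hx]
      have hftc : ∫ t in (0 : ℝ)..x, (P' t i j : ℂ) = (P x i j : ℂ) - P 0 i j := by
        rw [intervalIntegral.integral_ofReal]
        rw [intervalIntegral.integral_eq_sub_of_hasDeriv_right_of_le hx.1 (f := fun t => P t i j)]
        · simp
        · exact fun y hy => ((hp y ⟨hy.1, hy.2.trans hx.2⟩).continuousWithinAt).mono
            (Set.Icc_subset_Icc_right hx.2)
        · intro y hy
          exact ((hp y ⟨hy.1.le, hy.2.le.trans hx.2⟩).hasDerivAt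
            (Icc_mem_nhds hy.1 (hy.2.trans_le hx.2))).hasDerivWithinAt
        · refine ContinuousOn.intervalIntegrable ((hP'c j).mono ?_)
          rw [← Set.uIcc_of_le hL.le]
          exact hsub
      rw [hftc]
      ring
  refine ⟨?_, fun x hx => ?_⟩
  · have := IntervalIntegrable.sum (μ := volume) (a := 0) (b := L) Finset.univ
      (fun j _ => (main j).1)
    refine this.congr fun t _ => ?_
    simp
  · rw [intervalIntegral.integral_finsetSum fun j _ => (main j).1.mono_set (by
      rw [Set.uIcc_of_le hL.le, Set.uIcc_of_le hx.1]
      exact Set.Icc_subset_Icc_right hx.2), ← Finset.sum_add_distrib]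
    exact Finset.sum_congr rfl fun j _ => (main j).2 x hx

section Jets

variable {D : RealDiffExpr} {v : Fin (D.n + 1) → ℝ → ℂ}

theorem IsSobolevJet.continuousOn (hv : IsSobolevJet D v) (j : Fin D.n) :
    ContinuousOn (v j.castSucc) (Set.Icc 0 D.L) :=
  ((continuousOn_const (c := v j.castSucc 0)).add
    (continuousOn_primitive D.L_pos.le (hv.integrable j))).congr (hv.antideriv j)

/-- A function in the Sobolev space determines its jet: if it vanishes almost everywhere, so do all
its derivatives, and those of order below `n` vanish everywhere on `[0, L]`. -/
theorem IsSobolevJet.eq_zero (hv : IsSobolevJet D v)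
    (h : v 0 =ᵐ[(volume : Measure ℝ).restrict (Set.Icc 0 D.L)] 0) :
    (∀ j, v j =ᵐ[(volume : Measure ℝ).restrict (Set.Icc 0 D.L)] 0) ∧
      ∀ j : Fin D.n, ∀ x ∈ Set.Icc 0 D.L, v j.castSucc x = 0 := by
  have hz : ∀ j : Fin D.n, v j.castSucc =ᵐ[(volume : Measure ℝ).restrict (Set.Icc 0 D.L)] 0 →
      ∀ x ∈ Set.Icc 0 D.L, v j.castSucc x = 0 := fun j hj =>
    Measure.eqOn_Icc_of_ae_eq volume D.L_pos.ne hj (hv.continuousOn j) continuousOn_const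
  have hall : ∀ j, v j =ᵐ[(volume : Measure ℝ).restrict (Set.Icc 0 D.L)] 0 := fun j => by
    induction j using Fin.induction with
    | zero => exact h
    | succ j ih =>
      refine ae_eq_zero_of_integral_eq_zero D.L_pos.le (hv.integrable j) fun x hx => ?_
      have := hv.antideriv j x hx
      rw [hz j ih x hx, hz j ih 0 ⟨le_rfl, D.L_pos.le⟩, zero_add] at this
      exact this.symm
  exact ⟨hall, fun j => hz j (hall _)⟩

/-- The scalar equation `a 0 * v 0 + ⋯ + a n * v n = z * v 0 + f` in the form of the first order
system. -/
theorem sum_companion_mul {z x : ℝ} (hx : x ∈ Set.Icc 0 D.L) {v : Fin (D.n + 1) → ℂ} {f : ℂ}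
    (h : ∑ j, (D.a j x : ℂ) * v j = z * v 0 + f) (i : Fin D.n) :
    ∑ k, (companion D z x i k : ℂ) * v k.castSucc +
      (if (i : ℕ) + 1 < D.n then 0 else f / D.a (Fin.last D.n) x) = v i.succ := by
  have ha : (D.a (Fin.last D.n) x : ℂ) ≠ 0 := by exact_mod_cast D.lead_ne_zero x hx
  by_cases hi : (i : ℕ) + 1 < D.n
  · have : i.succ = Fin.castSucc ⟨i + 1, hi⟩ := by ext; simp
    simp only [companion, Matrix.of_apply, hi, if_true, add_zero, this]
    rw [Finset.sum_eq_single ⟨i + 1, hi⟩]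
    · simp
    · intro k _ hk
      have : ¬ (k : ℕ) = i + 1 := fun h => hk (Fin.ext h)
      simp [this]
    · simp
  · have hl : i.succ = Fin.last D.n := by
      ext
      have := i.2
      simp
      omega
    simp only [companion, Matrix.of_apply, hi, if_false, hl]
    rw [Fin.sum_univ_castSucc] at h
    have hs : ∑ k : Fin D.n, (if (k : ℕ) = 0 then (z : ℂ) else 0) * v k.castSucc = z * v 0 := by
      rw [Finset.sum_eq_single ⟨0, D.n_pos⟩]
      · simp
      · intro k _ hk
        have : ¬ (k : ℕ) = 0 := fun h => hk (Fin.ext h)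
        simp [this]
      · simp
    have e : ∀ k : Fin D.n, ((((if (k : ℕ) = 0 then z else 0) - D.a k.castSucc x) /
        D.a (Fin.last D.n) x : ℝ) : ℂ) * v k.castSucc =
        ((if (k : ℕ) = 0 then (z : ℂ) else 0) * v k.castSucc - D.a k.castSucc x * v k.castSucc) /
          D.a (Fin.last D.n) x := fun k => by
      push_cast
      rw [apply_ite (Complex.ofReal)]
      push_cast
      ring
    simp only [e]
    rw [← Finset.sum_div, Finset.sum_sub_distrib, hs, ← add_div, div_eq_iff ha]
    linear_combination -h

/-- A jet that solves the homogeneous equation is obtained from its initial vector by the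
fundamental matrix. -/
theorem IsSobolevJet.eq_fundamental_mulVec (hv : IsSobolevJet D v) {z : ℝ}
    (h : ∀ᵐ x ∂(volume : Measure ℝ).restrict (Set.Icc 0 D.L),
      ∑ j, (D.a j x : ℂ) * v j x = z * v 0 x) {x : ℝ} (hx : x ∈ Set.Icc 0 D.L) :
    (fun j : Fin D.n => v j.castSucc x) =
      (complexify (fundamental D z x)).mulVec fun j => v j.castSucc 0 := by
  have key : (complexify (fundamental D z x)⁻¹).mulVec (fun j : Fin D.n => v j.castSucc x) =
      fun j => v j.castSucc 0 := by
    ext i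
    have hm := (matrix_mulVec_eq_integral D.L_pos (P := fun x => (fundamental D z x)⁻¹)
      (P' := fun x => -((fundamental D z x)⁻¹ * companion D z x))
      (q := fun j => v j.castSucc) (g := fun j => v j.succ)
      (fun x hx => hasDerivWithinAt_matrix.1 (hasDerivWithinAt_fundamental_inv D z hx))
      (ContinuousOn.neg (ContinuousOn.mul
        (fun x hx => (hasDerivWithinAt_fundamental_inv D z hx).continuousWithinAt)
        (continuousOn_companion D z))) hv.integrable hv.antideriv i).2 x hx
    have hz : ∫ t in (0 : ℝ)..x, ∑ j, (((-((fundamental D z t)⁻¹ * companion D z t)) i j : ℝ) *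
        v j.castSucc t + ((fundamental D z t)⁻¹ i j : ℂ) * v j.succ t) = 0 := by
      rw [intervalIntegral.integral_of_le hx.1]
      refine integral_eq_zero_of_ae ?_
      refine ae_mono (Measure.restrict_mono (Set.Ioc_subset_Icc_self.trans
        (Set.Icc_subset_Icc_right hx.2)) le_rfl) ?_
      filter_upwards [h, ae_restrict_mem measurableSet_Icc] with t ht htI
      have hs := sum_companion_mul (v := fun j => v j t) (f := 0) htI (by simpa using ht)
      simp only [zero_div, ite_self, add_zero] at hs
      simp only [← hs, Pi.zero_apply, Finset.sum_add_distrib]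
      simp only [Matrix.neg_apply, Matrix.mul_apply, Complex.ofReal_neg, Complex.ofReal_sum,
        Complex.ofReal_mul, neg_mul, Finset.sum_mul, Finset.mul_sum, Finset.sum_neg_distrib]
      rw [neg_add_eq_zero, Finset.sum_comm]
      simp only [mul_assoc]
    rw [hz, add_zero, fundamental_zero, inv_one] at hm
    simpa [Matrix.mulVec, dotProduct, Matrix.one_apply, apply_ite] using hm
  rw [← key, Matrix.mulVec_mulVec, ← complexify_mul,
    Matrix.mul_nonsing_inv _ (isUnit_det_fundamental D z hx), complexify_one, Matrix.one_mulVec]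

end Jets

/-! ### Solutions of the boundary value problem and the Green kernel -/

section Green

variable {D : RealDiffExpr} {bc : BoundaryCondition D.n} {z : ℝ}

/-- `v` is the jet of a solution `u` of `(𝓛 - z) u = f` which satisfies the boundary conditions. -/
structure IsSolution (D : RealDiffExpr) (bc : BoundaryCondition D.n) (z : ℝ) (f : ℝ → ℂ)
    (v : Fin (D.n + 1) → ℝ → ℂ) : Prop where
  jet : IsSobolevJet D v
  eqn : ∀ᵐ x ∂(volume : Measure ℝ).restrict (Set.Icc 0 D.L),
    ∑ j, (D.a j x : ℂ) * v j x = z * v 0 x + f x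
  holds : bc.Holds (fun j => v j.castSucc 0) (fun j => v j.castSucc D.L)

theorem IsSolution.add {f g : ℝ → ℂ} {v w : Fin (D.n + 1) → ℝ → ℂ}
    (hv : IsSolution D bc z f v) (hw : IsSolution D bc z g w) :
    IsSolution D bc z (fun x => f x + g x) (fun j x => v j x + w j x) where
  jet := hv.jet.add hw.jet
  eqn := by
    filter_upwards [hv.eqn, hw.eqn] with x h1 h2
    simp only [mul_add, Finset.sum_add_distrib, h1, h2]
    ring
  holds := hv.holds.add hw.holds

theorem IsSolution.smul {f : ℝ → ℂ} {v : Fin (D.n + 1) → ℝ → ℂ}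
    (hv : IsSolution D bc z f v) (c : ℂ) :
    IsSolution D bc z (fun x => c * f x) (fun j x => c * v j x) where
  jet := hv.jet.smul c
  eqn := by
    filter_upwards [hv.eqn] with x h1
    simp only [mul_left_comm _ c, ← Finset.mul_sum, h1]
    ring
  holds := hv.holds.smul c

theorem IsSolution.congr {f g : ℝ → ℂ} {v : Fin (D.n + 1) → ℝ → ℂ}
    (hv : IsSolution D bc z f v)
    (h : f =ᵐ[(volume : Measure ℝ).restrict (Set.Icc 0 D.L)] g) : IsSolution D bc z g v where
  jet := hv.jet
  eqn := by
    filter_upwards [hv.eqn, h] with x h1 h2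
    rw [h1, h2]
  holds := hv.holds

/-- The zero function solves only the homogeneous equation, so the operator is single valued and
`(𝓛 - z)⁻¹` is injective. -/
theorem IsSolution.rhs_ae_eq_zero {f : ℝ → ℂ} {v : Fin (D.n + 1) → ℝ → ℂ}
    (hv : IsSolution D bc z f v)
    (h : v 0 =ᵐ[(volume : Measure ℝ).restrict (Set.Icc 0 D.L)] 0) :
    f =ᵐ[(volume : Measure ℝ).restrict (Set.Icc 0 D.L)] 0 := by
  have hall := ae_all_iff.2 (hv.jet.eq_zero h).1
  filter_upwards [hall, hv.eqn] with x hx he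
  simpa [hx] using he.symm

/-- Uniqueness for the boundary value problem where the Evans function does not vanish. -/
theorem IsSolution.eq_zero (hE : evans D bc z ≠ 0) {v : Fin (D.n + 1) → ℝ → ℂ}
    (hv : IsSolution D bc z (fun _ => 0) v) {x : ℝ} (hx : x ∈ Set.Icc 0 D.L) : v 0 x = 0 := by
  have hw := fun {x : ℝ} (hx : x ∈ Set.Icc 0 D.L) =>
    hv.jet.eq_fundamental_mulVec (z := z) (by simpa using hv.eqn) hx
  have hh := hv.holds
  rw [hw ⟨D.L_pos.le, le_rfl⟩] at hh
  have h0 := initial_eq_zero_of_evans_ne_zero D bc z hE hh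
  have := congrFun (hw hx) ⟨0, D.n_pos⟩
  rw [h0, Matrix.mulVec_zero] at this
  exact this

theorem IsSolution.eqOn (hE : evans D bc z ≠ 0) {f : ℝ → ℂ} {v w : Fin (D.n + 1) → ℝ → ℂ}
    (hv : IsSolution D bc z f v) (hw : IsSolution D bc z f w) {x : ℝ}
    (hx : x ∈ Set.Icc 0 D.L) : v 0 x = w 0 x := by
  have h := (hv.add (hw.smul (-1))).congr (g := fun _ => 0)
    (Eventually.of_forall fun x => by simp)
  have := h.eq_zero hE hx
  linear_combination this

theorem memLp_of_continuousOn {L : ℝ} {g : ℝ → ℂ} (hg : ContinuousOn g (Set.Icc 0 L)) :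
    MemLp g 2 ((volume : Measure ℝ).restrict (Set.Icc 0 L)) := by
  obtain ⟨C, hC⟩ := isCompact_Icc.exists_bound_of_continuousOn hg
  exact MemLp.of_bound (hg.aestronglyMeasurable measurableSet_Icc) C
    ((ae_restrict_iff' measurableSet_Icc).2 (Eventually.of_forall hC))

theorem memLp_continuousOn_mul {L : ℝ} {g f : ℝ → ℂ} (hg : ContinuousOn g (Set.Icc 0 L))
    (hf : MemLp f 2 ((volume : Measure ℝ).restrict (Set.Icc 0 L))) :
    MemLp (fun x => g x * f x) 2 ((volume : Measure ℝ).restrict (Set.Icc 0 L)) := by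
  obtain ⟨C, hC⟩ := isCompact_Icc.exists_bound_of_continuousOn hg
  refine hf.of_le_mul (c := C) ((hg.aestronglyMeasurable measurableSet_Icc).mul
    hf.aestronglyMeasurable) ((ae_restrict_iff' measurableSet_Icc).2
      (Eventually.of_forall fun x hx => ?_))
  rw [norm_mul]
  exact mul_le_mul_of_nonneg_right (hC x hx) (norm_nonneg _)

theorem intervalIntegrable_of_memLp {L : ℝ} (hL : 0 ≤ L) {f : ℝ → ℂ}
    (hf : MemLp f 2 ((volume : Measure ℝ).restrict (Set.Icc 0 L))) :
    IntervalIntegrable f volume 0 L := by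
  rw [intervalIntegrable_iff_integrableOn_Icc_of_le hL]
  exact hf.integrable one_le_two

theorem continuousOn_ofReal {g : ℝ → ℝ} {s : Set ℝ} (hg : ContinuousOn g s) :
    ContinuousOn (fun x => (g x : ℂ)) s :=
  Complex.continuous_ofReal.comp_continuousOn hg

variable (D) in
theorem continuousOn_fundamental_inv (z : ℝ) :
    ContinuousOn (fun x => (fundamental D z x)⁻¹) (Set.Icc 0 D.L) :=
  fun _ hx => (hasDerivWithinAt_fundamental_inv D z hx).continuousWithinAt

variable (D) in
/-- The integrand of the variation of constants formula: the last column of the inverse fundamental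
matrix, times the forcing term `f / a n`. -/
def forcing (z : ℝ) (f : ℝ → ℂ) (j : Fin D.n) (y : ℝ) : ℂ :=
  ((fundamental D z y)⁻¹ j ⟨D.n - 1, Nat.sub_lt D.n_pos Nat.one_pos⟩ / D.a (Fin.last D.n) y : ℝ) *
    f y

theorem memLp_forcing {f : ℝ → ℂ}
    (hf : MemLp f 2 ((volume : Measure ℝ).restrict (Set.Icc 0 D.L))) (j : Fin D.n) :
    MemLp (forcing D z f j) 2 ((volume : Measure ℝ).restrict (Set.Icc 0 D.L)) := by
  refine memLp_continuousOn_mul (continuousOn_ofReal (ContinuousOn.div ?_ (D.continuousOn _)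
    D.lead_ne_zero)) hf
  exact continuousOn_pi.1 (continuousOn_pi.1 (continuousOn_fundamental_inv D z) j) _

theorem intervalIntegrable_forcing {f : ℝ → ℂ}
    (hf : MemLp f 2 ((volume : Measure ℝ).restrict (Set.Icc 0 D.L))) (j : Fin D.n) :
    IntervalIntegrable (forcing D z f j) volume 0 D.L :=
  intervalIntegrable_of_memLp D.L_pos.le (memLp_forcing hf j)

/-- Variation of constants: `U(x) (c + ∫₀ˣ U(y)⁻¹ F(y) dy)` is the jet of a solution of
`(𝓛 - z) u = f`. -/
theorem exists_jet_variation_of_constants {f : ℝ → ℂ}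
    (hf : MemLp f 2 ((volume : Measure ℝ).restrict (Set.Icc 0 D.L))) (c : Fin D.n → ℂ) :
    ∃ v, IsSobolevJet D v ∧ (∀ x ∈ Set.Icc 0 D.L,
      ∑ j, (D.a j x : ℂ) * v j x = z * v 0 x + f x) ∧
      ∀ x (i : Fin D.n), v i.castSucc x = ∑ j, (fundamental D z x i j : ℂ) *
        (c j + ∫ y in (0 : ℝ)..x, forcing D z f j y) := by
  set q : Fin D.n → ℝ → ℂ := fun j x => c j + ∫ y in (0 : ℝ)..x, forcing D z f j y with hq
  set w : Fin D.n → ℝ → ℂ := fun i x => ∑ j, (fundamental D z x i j : ℂ) * q j x with hw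
  set l : ℝ → ℂ := fun x => (((D.a (Fin.last D.n) x)⁻¹ : ℝ) : ℂ) *
    (z * w ⟨0, D.n_pos⟩ x - ∑ k : Fin D.n, (D.a k.castSucc x : ℂ) * w k x + f x) with hl
  set v : Fin (D.n + 1) → ℝ → ℂ := Fin.snoc (α := fun _ => ℝ → ℂ) w l with hv
  have hvc : ∀ i : Fin D.n, v i.castSucc = w i := fun i => Fin.snoc_castSucc (α := fun _ => ℝ → ℂ)
    l w i
  have hvl : v (Fin.last D.n) = l := Fin.snoc_last (α := fun _ => ℝ → ℂ) l w
  have hv0 : v 0 = w ⟨0, D.n_pos⟩ := hvc ⟨0, D.n_pos⟩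
  have heq : ∀ x ∈ Set.Icc 0 D.L, ∑ j, (D.a j x : ℂ) * v j x = z * v 0 x + f x := fun x hx => by
    have ha : (D.a (Fin.last D.n) x : ℂ) ≠ 0 := by exact_mod_cast D.lead_ne_zero x hx
    rw [Fin.sum_univ_castSucc, hvl, hv0, hl]
    simp only [hvc, Complex.ofReal_inv]
    rw [mul_inv_cancel_left₀ ha]
    ring
  have hprod := fun i => matrix_mulVec_eq_integral D.L_pos (P := fundamental D z)
    (P' := fun x => companion D z x * fundamental D z x) (q := q) (g := forcing D z f)
    (fun x hx => hasDerivWithinAt_matrix.1 (hasDerivWithinAt_fundamental D z hx))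
    ((continuousOn_companion D z).mul (continuousOn_fundamental D z))
    (intervalIntegrable_forcing hf) (fun j x _ => by simp [hq]) i
  have hder : ∀ i : Fin D.n, ∀ x ∈ Set.Icc 0 D.L,
      ∑ j, (((companion D z x * fundamental D z x) i j : ℂ) * q j x +
        (fundamental D z x i j : ℂ) * forcing D z f j x) = v i.succ x := fun i x hx => by
    rw [← sum_companion_mul hx (v := fun j => v j x) (heq x hx) i, Finset.sum_add_distrib]
    congr 1
    · simp only [hvc, hw, Finset.mul_sum, Matrix.mul_apply, Complex.ofReal_sum, Complex.ofReal_mul,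
        Finset.sum_mul]
      rw [Finset.sum_comm]
      simp only [mul_assoc]
    · have h1 : ∑ j, fundamental D z x i j *
          (fundamental D z x)⁻¹ j ⟨D.n - 1, Nat.sub_lt D.n_pos Nat.one_pos⟩ =
          if (i : ℕ) + 1 < D.n then 0 else 1 := by
        rw [← Matrix.mul_apply, Matrix.mul_nonsing_inv _ (isUnit_det_fundamental D z hx),
          Matrix.one_apply]
        have hi : i = ⟨D.n - 1, Nat.sub_lt D.n_pos Nat.one_pos⟩ ↔ ¬ (i : ℕ) + 1 < D.n := by
          rw [Fin.ext_iff]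
          have := i.2
          simp only
          omega
        simp only [hi]
        split_ifs <;> rfl
      have h2 : ∀ j, (fundamental D z x i j : ℂ) * forcing D z f j x =
          ((fundamental D z x i j * (fundamental D z x)⁻¹ j
            ⟨D.n - 1, Nat.sub_lt D.n_pos Nat.one_pos⟩ : ℝ) : ℂ) *
              (f x / D.a (Fin.last D.n) x) := fun j => by
        simp only [forcing]
        push_cast
        ring
      simp only [h2]
      rw [← Finset.sum_mul, ← Complex.ofReal_sum, h1]
      split_ifs <;> simp
  have huI : Set.uIoc 0 D.L ⊆ Set.Icc 0 D.L := by
    rw [Set.uIoc_of_le D.L_pos.le]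
    exact Set.Ioc_subset_Icc_self
  have hint : ∀ j : Fin D.n, IntervalIntegrable (v j.succ) volume 0 D.L := fun j =>
    (hprod j).1.congr fun x hx => hder j x (huI hx)
  have hanti : ∀ j : Fin D.n, ∀ x ∈ Set.Icc 0 D.L,
      v j.castSucc x = v j.castSucc 0 + ∫ t in (0 : ℝ)..x, v j.succ t := fun j x hx => by
    rw [hvc]
    refine ((hprod j).2 x hx).trans ?_
    congr 1
    refine intervalIntegral.integral_congr fun t ht => hder j t ?_
    rw [Set.uIcc_of_le hx.1] at ht
    exact ⟨ht.1, ht.2.trans hx.2⟩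
  have hcont : ∀ j, ContinuousOn (w j) (Set.Icc 0 D.L) := fun j => by
    refine continuousOn_finsetSum _ fun k _ => (continuousOn_ofReal (continuousOn_pi.1
      (continuousOn_pi.1 (continuousOn_fundamental D z) j) k)).mul (continuousOn_const.add
        (continuousOn_primitive D.L_pos.le (intervalIntegrable_forcing hf k)))
  refine ⟨v, ⟨hint, hanti, ?_⟩, heq, fun x i => by rw [hvc]⟩
  rw [hvl]
  refine memLp_continuousOn_mul (continuousOn_ofReal ((D.continuousOn _).inv₀ D.lead_ne_zero))
    (MemLp.add (memLp_of_continuousOn ?_) hf)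
  exact (continuousOn_const.mul (hcont _)).sub (continuousOn_finsetSum _ fun k _ =>
    (continuousOn_ofReal (D.continuousOn _)).mul (hcont k))

/-- The Green kernel as a combination of the forcing integrands, on either side of the diagonal. -/
theorem greenKernel_mul {x y : ℝ} (f : ℝ → ℂ) :
    (greenKernel D bc z x y : ℂ) * f y = ∑ j, (((if y < x then fundamental D z x *
      (evans D bc z • (1 : Matrix (Fin D.n) (Fin D.n) ℝ) - projector D bc z) else
      -(fundamental D z x * projector D bc z)) ⟨0, D.n_pos⟩ j : ℝ) : ℂ) * forcing D z f j y := by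
  have h : ∀ Q : Matrix (Fin D.n) (Fin D.n) ℝ, (((Q * (fundamental D z y)⁻¹) ⟨0, D.n_pos⟩
      ⟨D.n - 1, Nat.sub_lt D.n_pos Nat.one_pos⟩ / D.a (Fin.last D.n) y : ℝ) : ℂ) * f y =
        ∑ j, (Q ⟨0, D.n_pos⟩ j : ℂ) * forcing D z f j y := fun Q => by
    simp only [forcing, Matrix.mul_apply, Finset.sum_div, Complex.ofReal_sum, Finset.sum_mul]
    refine Finset.sum_congr rfl fun j _ => ?_
    push_cast
    ring
  rw [← h, greenKernel, greenMatrix]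
  split_ifs
  · rfl
  · rw [Matrix.neg_mul]

/-- Integration against the Green kernel, in terms of the variation of constants formula. -/
theorem integral_greenKernel_mul {f : ℝ → ℂ}
    (hf : MemLp f 2 ((volume : Measure ℝ).restrict (Set.Icc 0 D.L))) {x : ℝ}
    (hx : x ∈ Set.Icc 0 D.L) :
    ∫ y in (0 : ℝ)..D.L, (greenKernel D bc z x y : ℂ) * f y =
      ∑ j, ((evans D bc z : ℂ) * fundamental D z x ⟨0, D.n_pos⟩ j *
          (∫ y in (0 : ℝ)..x, forcing D z f j y) -
        ((fundamental D z x * projector D bc z) ⟨0, D.n_pos⟩ j : ℂ) *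
          ∫ y in (0 : ℝ)..D.L, forcing D z f j y) := by
  have hi := fun j => intervalIntegrable_forcing (z := z) hf j
  have hi1 : ∀ j, IntervalIntegrable (forcing D z f j) volume 0 x := fun j =>
    (hi j).mono_set (by
      rw [Set.uIcc_of_le hx.1, Set.uIcc_of_le D.L_pos.le]
      exact Set.Icc_subset_Icc_right hx.2)
  have hi2 : ∀ j, IntervalIntegrable (forcing D z f j) volume x D.L := fun j =>
    (hi j).mono_set (by
      rw [Set.uIcc_of_le hx.2, Set.uIcc_of_le D.L_pos.le]
      exact Set.Icc_subset_Icc_left hx.1)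
  have key : ∀ (Q : Matrix (Fin D.n) (Fin D.n) ℝ) (a b : ℝ),
      (∀ j, IntervalIntegrable (forcing D z f j) volume a b) →
      (∀ᵐ y, y ∈ Set.uIoc a b → (greenKernel D bc z x y : ℂ) * f y =
        ∑ j, (Q ⟨0, D.n_pos⟩ j : ℂ) * forcing D z f j y) →
      IntervalIntegrable (fun y => (greenKernel D bc z x y : ℂ) * f y) volume a b ∧
      ∫ y in a..b, (greenKernel D bc z x y : ℂ) * f y =
        ∑ j, (Q ⟨0, D.n_pos⟩ j : ℂ) * ∫ y in a..b, forcing D z f j y := fun Q a b hab h => by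
    have hs : IntervalIntegrable (fun y => ∑ j, (Q ⟨0, D.n_pos⟩ j : ℂ) * forcing D z f j y)
        volume a b := by
      have := IntervalIntegrable.sum (μ := volume) (a := a) (b := b) Finset.univ
        (fun j _ => (hab j).const_mul (Q ⟨0, D.n_pos⟩ j : ℂ))
      refine this.congr fun t _ => ?_
      simp
    refine ⟨hs.congr_ae ?_, ?_⟩
    · refine (ae_restrict_iff' measurableSet_uIoc).2 (h.mono fun y hy hy' => (hy hy').symm)
    · rw [intervalIntegral.integral_congr_ae h,
        intervalIntegral.integral_finsetSum fun j _ => (hab j).const_mul _]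
      simp only [intervalIntegral.integral_const_mul]
  have hne : ∀ᵐ y : ℝ, y ≠ x := by simp [ae_iff]
  have h1 := key _ 0 x hi1 (by
    filter_upwards [hne] with y hy hy'
    rw [Set.uIoc_of_le hx.1] at hy'
    have := greenKernel_mul (D := D) (bc := bc) (z := z) (x := x) (y := y) f
    rwa [if_pos (lt_of_le_of_ne hy'.2 hy)] at this)
  have h2 := key _ x D.L hi2 (by
    refine Eventually.of_forall fun y hy' => ?_
    rw [Set.uIoc_of_le hx.2] at hy'
    have := greenKernel_mul (D := D) (bc := bc) (z := z) (x := x) (y := y) f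
    rwa [if_neg (not_lt.2 hy'.1.le)] at this)
  rw [← intervalIntegral.integral_add_adjacent_intervals h1.1 h2.1, h1.2, h2.2,
    ← Finset.sum_add_distrib]
  refine Finset.sum_congr rfl fun j _ => ?_
  rw [← intervalIntegral.integral_add_adjacent_intervals (hi1 j) (hi2 j), Matrix.mul_sub,
    Matrix.mul_smul, Matrix.mul_one]
  simp only [Matrix.sub_apply, Matrix.smul_apply, Matrix.neg_apply, smul_eq_mul]
  push_cast
  ring

/-- Where the Evans function does not vanish, the boundary value problem is solvable for every
square integrable right hand side, and `G` is `E` times the kernel of the solution operator. -/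
theorem exists_isSolution (hE : evans D bc z ≠ 0) {f : ℝ → ℂ}
    (hf : MemLp f 2 ((volume : Measure ℝ).restrict (Set.Icc 0 D.L))) :
    ∃ v, IsSolution D bc z f v ∧ ∀ x ∈ Set.Icc 0 D.L, (evans D bc z : ℂ) * v 0 x =
      ∫ y in (0 : ℝ)..D.L, (greenKernel D bc z x y : ℂ) * f y := by
  have hE' : (evans D bc z : ℂ) ≠ 0 := by exact_mod_cast hE
  set r : Fin D.n → ℂ := fun j => ∫ y in (0 : ℝ)..D.L, forcing D z f j y with hr
  set c : Fin D.n → ℂ :=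
    -((evans D bc z : ℂ)⁻¹ • (complexify (projector D bc z)).mulVec r) with hc
  obtain ⟨v, hv, heq, hform⟩ := exists_jet_variation_of_constants (z := z) hf c
  refine ⟨v, ⟨hv, (ae_restrict_iff' measurableSet_Icc).2 (Eventually.of_forall heq), ?_⟩,
    fun x hx => ?_⟩
  · have hh := holds_neg_projector_mulVec D bc z hE r
    rw [← hc] at hh
    convert hh using 1
    · ext i
      rw [hform]
      simp [fundamental_zero, Matrix.one_apply, apply_ite]
    · ext i
      rw [hform]
      rfl
  · have h0 : v 0 x = _ := hform x ⟨0, D.n_pos⟩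
    rw [h0, integral_greenKernel_mul hf hx]
    simp only [mul_add, Finset.sum_add_distrib, Finset.mul_sum, Finset.sum_sub_distrib]
    have e : ∑ j, (evans D bc z : ℂ) * ((fundamental D z x ⟨0, D.n_pos⟩ j : ℂ) * c j) =
        -∑ j, ((fundamental D z x * projector D bc z) ⟨0, D.n_pos⟩ j : ℂ) * r j := by
      have e1 : (complexify (fundamental D z x * projector D bc z)).mulVec r =
          -((evans D bc z : ℂ) • (complexify (fundamental D z x)).mulVec c) := by
        rw [hc, Matrix.mulVec_neg, Matrix.mulVec_smul, smul_neg, smul_smul, mul_inv_cancel₀ hE',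
          one_smul, neg_neg, complexify_mul, ← Matrix.mulVec_mulVec]
      have e2 := congrFun e1 ⟨0, D.n_pos⟩
      rw [← Finset.mul_sum]
      refine (neg_eq_iff_eq_neg.2 ?_).symm
      exact e2
    rw [e]
    simp only [← mul_assoc]
    ring

/-- Where the Evans function vanishes there is a real eigenfunction. -/
theorem exists_eigenjet (hE : evans D bc z = 0) :
    ∃ (u : ℝ → ℝ) (v : Fin (D.n + 1) → ℝ → ℂ), IsSolution D bc z (fun _ => 0) v ∧
      (∀ x ∈ Set.Icc 0 D.L, v 0 x = u x) ∧ ContinuousOn u (Set.Icc 0 D.L) ∧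
      ∃ x ∈ Set.Icc 0 D.L, u x ≠ 0 := by
  obtain ⟨c, hc0, hc⟩ := exists_initial_of_evans_eq_zero D bc z hE
  obtain ⟨v, hv, heq, hform⟩ := exists_jet_variation_of_constants (z := z) (f := fun _ => 0)
    (MemLp.zero' : MemLp _ 2 _) (fun j => (c j : ℂ))
  have hform' : ∀ x, (fun i : Fin D.n => v i.castSucc x) =
      (complexify (fundamental D z x)).mulVec fun j => (c j : ℂ) := fun x => by
    ext i
    rw [hform]
    simp [forcing, Matrix.mulVec, dotProduct]
  have hsol : IsSolution D bc z (fun _ => 0) v := by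
    refine ⟨hv, (ae_restrict_iff' measurableSet_Icc).2 (Eventually.of_forall heq), ?_⟩
    rw [hform', hform', fundamental_zero, complexify_one, Matrix.one_mulVec]
    exact hc
  have hu : ∀ x, v 0 x = ((fundamental D z x).mulVec c ⟨0, D.n_pos⟩ : ℝ) := fun x => by
    have := congrFun (hform' x) ⟨0, D.n_pos⟩
    rw [complexify_mulVec_ofReal] at this
    exact this
  refine ⟨fun x => (fundamental D z x).mulVec c ⟨0, D.n_pos⟩, v, hsol, fun x _ => hu x, ?_, ?_⟩
  · exact continuousOn_pi.1 ((continuous_id.matrix_mulVec continuous_const).comp_continuousOn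
      (continuousOn_fundamental D z)) _
  · by_contra! hcon
    refine hc0 ?_
    have h0 := (hv.eq_zero ((ae_restrict_iff' measurableSet_Icc).2 (Eventually.of_forall
      fun x hx => by simp [hu x, hcon x hx]))).2
    ext j
    have h1 := congrFun (hform' 0) j
    simp only [h0 j 0 ⟨le_rfl, D.L_pos.le⟩] at h1
    rw [fundamental_zero, complexify_one, Matrix.one_mulVec] at h1
    exact_mod_cast h1.symm

end Green

/-! ### The real spectrum is the zero set of the Evans function -/

section Spectrum

variable {D : RealDiffExpr} {bc : BoundaryCondition D.n} {z : ℝ}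

theorem exists_isSolution_of_mem_graph {u g : H D} (h : (u, g) ∈ graph D bc) (z : ℝ) :
    ∃ v, IsSolution D bc z (fun x => g x - z * u x) v ∧
      (u : ℝ → ℂ) =ᵐ[(volume : Measure ℝ).restrict (Set.Icc 0 D.L)] v 0 := by
  obtain ⟨v, hv, hu, hg, hb⟩ := h
  refine ⟨v, ⟨hv, ?_, hb⟩, hu⟩
  filter_upwards [hu, hg] with x h1 h2
  rw [h1, h2]
  ring

theorem IsSolution.exists_mem_graph {f : H D} {v : Fin (D.n + 1) → ℝ → ℂ}
    (hv : IsSolution D bc z f v) : ∃ u : H D, (u, f + (z : ℂ) • u) ∈ graph D bc ∧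
      (u : ℝ → ℂ) =ᵐ[(volume : Measure ℝ).restrict (Set.Icc 0 D.L)] v 0 := by
  have hm : MemLp (v 0) 2 ((volume : Measure ℝ).restrict (Set.Icc 0 D.L)) :=
    memLp_of_continuousOn (hv.jet.continuousOn ⟨0, D.n_pos⟩)
  refine ⟨hm.toLp, ⟨v, hv.jet, hm.coeFn_toLp, ?_, hv.holds⟩, hm.coeFn_toLp⟩
  filter_upwards [Lp.coeFn_add f ((z : ℂ) • hm.toLp), Lp.coeFn_smul (z : ℂ) hm.toLp,
    hm.coeFn_toLp, hv.eqn] with x h1 h2 h3 h4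
  rw [h4]
  rw [h1, Pi.add_apply, h2, Pi.smul_apply, h3, smul_eq_mul, add_comm]

variable (D bc) in
theorem graph_singleValued :
    ∀ x : H D × H D, x ∈ graph D bc → x.1 = 0 → x.2 = 0 := by
  rintro ⟨u, g⟩ h hu
  simp only at hu
  subst hu
  obtain ⟨v, hv, hv0⟩ := exists_isSolution_of_mem_graph h 0
  have h0 := Lp.coeFn_zero ℂ 2 ((volume : Measure ℝ).restrict (Set.Icc 0 D.L))
  have hf := hv.rhs_ae_eq_zero (hv0.symm.trans h0)
  refine Lp.ext (Filter.EventuallyEq.trans ?_ h0.symm)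
  filter_upwards [hf] with x hx
  simpa using hx

variable (D bc) in
theorem operator_graph : (operator D bc).graph = graph D bc :=
  Submodule.toLinearPMap_graph_eq _ (graph_singleValued D bc)

theorem evans_ne_zero_of_mem_resolventSet (hz : (z : ℂ) ∈ resolventSet (operator D bc)) :
    evans D bc z ≠ 0 := by
  intro hE
  obtain ⟨R, -, hR⟩ := hz
  obtain ⟨u, v, hv, hvu, hu, x₀, hx₀, hux⟩ := exists_eigenjet hE
  have h0 := Lp.coeFn_zero ℂ 2 ((volume : Measure ℝ).restrict (Set.Icc 0 D.L))
  obtain ⟨w, hw, hwv⟩ := (hv.congr h0.symm).exists_mem_graph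
  rw [zero_add, ← operator_graph, LinearPMap.mem_graph_iff] at hw
  obtain ⟨y, hy1, hy2⟩ := hw
  have h1 := hR y
  simp only at hy1 hy2
  rw [hy2, hy1, sub_self, map_zero] at h1
  rw [← h1] at hwv
  have h2 := (hv.jet.eq_zero (hwv.symm.trans h0)).2 ⟨0, D.n_pos⟩ x₀ hx₀
  have h3 := (hvu x₀ hx₀).symm.trans h2
  exact hux (by exact_mod_cast h3)

theorem eq_zero_of_mem_graph (hE : evans D bc z ≠ 0) {u : H D}
    (h : (u, (z : ℂ) • u) ∈ graph D bc) : u = 0 := by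
  obtain ⟨v, hv, hv0⟩ := exists_isSolution_of_mem_graph h z
  have hv' := hv.congr (g := fun _ => 0) (by
    filter_upwards [Lp.coeFn_smul (z : ℂ) u] with x hx
    rw [hx]
    simp)
  refine Lp.ext (hv0.trans (EventuallyEq.trans ?_ (Lp.coeFn_zero ℂ 2 _).symm))
  exact (ae_restrict_iff' measurableSet_Icc).2 (Eventually.of_forall fun x hx => hv'.eq_zero hE hx)

/-- Where the Evans function does not vanish, the resolvent exists: the boundary value problem is
uniquely solvable, and the solution operator is bounded by the closed graph theorem. -/
theorem mem_resolventSet_of_evans_ne_zero (hsa : IsSelfAdjoint (operator D bc))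
    (hE : evans D bc z ≠ 0) : (z : ℂ) ∈ resolventSet (operator D bc) := by
  have hex : ∀ f : H D, ∃ u : H D, (u, f + (z : ℂ) • u) ∈ graph D bc := fun f => by
    obtain ⟨v, hv, -⟩ := exists_isSolution (bc := bc) hE (Lp.memLp f)
    obtain ⟨u, hu, -⟩ := hv.exists_mem_graph
    exact ⟨u, hu⟩
  choose S hS using hex
  have huniq : ∀ f u : H D, (u, f + (z : ℂ) • u) ∈ graph D bc → S f = u := fun f u hu => by
    refine sub_eq_zero.1 (eq_zero_of_mem_graph hE ?_)
    have := (graph D bc).sub_mem (hS f) hu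
    rwa [Prod.mk_sub_mk, add_sub_add_left_eq_sub, ← smul_sub] at this
  let R : H D →ₗ[ℂ] H D :=
    { toFun := S
      map_add' := fun f g => huniq _ _ (by
        have := (graph D bc).add_mem (hS f) (hS g)
        rwa [Prod.mk_add_mk, add_add_add_comm, ← smul_add] at this)
      map_smul' := fun c f => huniq _ _ (by
        have := (graph D bc).smul_mem c (hS f)
        rwa [Prod.smul_mk, smul_add, smul_comm c] at this) }
  have hcl : IsClosed (graph D bc : Set (H D × H D)) := by
    have := hsa.isClosed
    rw [LinearPMap.IsClosed, operator_graph] at this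
    exact this
  have hR : IsClosed (R.graph : Set (H D × H D)) := by
    have e : (R.graph : Set (H D × H D)) =
        (fun p : H D × H D => (p.2, p.1 + (z : ℂ) • p.2)) ⁻¹' graph D bc := by
      ext ⟨f, u⟩
      refine ⟨fun h => ?_, fun h => (huniq f u h).symm⟩
      have h' : u = S f := h
      rw [h']
      exact hS f
    rw [e]
    exact hcl.preimage (by fun_prop)
  refine ⟨⟨R, R.continuous_of_isClosed_graph hR⟩, fun f => ?_, fun u => ?_⟩
  · have h := hS f
    rw [← operator_graph, LinearPMap.mem_graph_iff] at h
    obtain ⟨y, hy1, hy2⟩ := h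
    simp only at hy1 hy2
    exact ⟨y, hy1, by rw [hy2, hy1, add_sub_cancel_right]⟩
  · refine huniq _ _ ?_
    rw [sub_add_cancel, ← operator_graph]
    exact (operator D bc).mem_graph u

/-- A real number belongs to the spectrum exactly if the Evans function vanishes there. -/
theorem mem_spectrum_iff (hsa : IsSelfAdjoint (operator D bc)) :
    (z : ℂ) ∈ spectrum (operator D bc) ↔ evans D bc z = 0 := by
  refine ⟨fun h => ?_, fun h h' => evans_ne_zero_of_mem_resolventSet h' h⟩
  by_contra hE
  exact h (mem_resolventSet_of_evans_ne_zero hsa hE)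

end Spectrum

/-! ### The weight and the length of a step -/

section Weight

variable {D : RealDiffExpr} {bc : BoundaryCondition D.n} {z : ℝ}

variable (D bc) in
/-- The Green kernel is given by two functions, continuous in the parameter and both variables, on
the two sides of the diagonal. -/
theorem exists_continuousOn_greenKernel :
    ∃ g₁ g₂ : ℝ × ℝ × ℝ → ℝ,
      ContinuousOn g₁ (Set.univ ×ˢ Set.Icc 0 D.L ×ˢ Set.Icc 0 D.L) ∧
      ContinuousOn g₂ (Set.univ ×ˢ Set.Icc 0 D.L ×ˢ Set.Icc 0 D.L) ∧
      ∀ z x y, greenKernel D bc z x y = if y < x then g₁ (z, x, y) else g₂ (z, x, y) := by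
  have hU : ContinuousOn (fun p : ℝ × ℝ × ℝ => fundamental D p.1 p.2.1)
      (Set.univ ×ˢ Set.Icc 0 D.L ×ˢ Set.Icc 0 D.L) :=
    (continuousOn_uncurry_fundamental D).comp (f := fun p : ℝ × ℝ × ℝ => (p.1, p.2.1))
      (by fun_prop) fun p hp => ⟨trivial, hp.2.1⟩
  have hV : ContinuousOn (fun p : ℝ × ℝ × ℝ => (fundamental D p.1 p.2.2)⁻¹)
      (Set.univ ×ˢ Set.Icc 0 D.L ×ˢ Set.Icc 0 D.L) :=
    (continuousOn_uncurry_fundamental_inv D).comp (f := fun p : ℝ × ℝ × ℝ => (p.1, p.2.2))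
      (by fun_prop) fun p hp => ⟨trivial, hp.2.2⟩
  have ha : ContinuousOn (fun p : ℝ × ℝ × ℝ => D.a (Fin.last D.n) p.2.2)
      (Set.univ ×ˢ Set.Icc 0 D.L ×ˢ Set.Icc 0 D.L) :=
    (D.continuousOn _).comp (f := fun p : ℝ × ℝ × ℝ => p.2.2) (by fun_prop) fun p hp => hp.2.2
  have hP : ContinuousOn (fun p : ℝ × ℝ × ℝ => projector D bc p.1)
      (Set.univ ×ˢ Set.Icc 0 D.L ×ˢ Set.Icc 0 D.L) :=
    ((continuous_projector D bc).comp continuous_fst).continuousOn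
  have hE : ContinuousOn (fun p : ℝ × ℝ × ℝ => evans D bc p.1)
      (Set.univ ×ˢ Set.Icc 0 D.L ×ˢ Set.Icc 0 D.L) :=
    ((continuous_evans D bc).comp continuous_fst).continuousOn
  have entry : ∀ {Q : ℝ × ℝ × ℝ → Matrix (Fin D.n) (Fin D.n) ℝ} {s : Set (ℝ × ℝ × ℝ)},
      ContinuousOn Q s → ∀ i j, ContinuousOn (fun p => Q p i j) s := fun hQ i j =>
    continuousOn_pi.1 (continuousOn_pi.1 hQ i) j
  have hE1 := hE.smul (continuousOn_const (c := (1 : Matrix (Fin D.n) (Fin D.n) ℝ)))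
  refine ⟨_, _, (entry ((hU.mul (hE1.sub hP)).mul hV) ⟨0, D.n_pos⟩
    ⟨D.n - 1, Nat.sub_lt D.n_pos Nat.one_pos⟩).div ha fun p hp => D.lead_ne_zero _ hp.2.2,
    (entry ((hU.mul hP).mul hV).neg ⟨0, D.n_pos⟩
    ⟨D.n - 1, Nat.sub_lt D.n_pos Nat.one_pos⟩).div ha fun p hp => D.lead_ne_zero _ hp.2.2,
    fun z x y => ?_⟩
  rw [greenKernel, greenMatrix]
  split_ifs <;> rfl

variable (D bc) in
theorem exists_bound_greenKernel (a b : ℝ) :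
    ∃ C, ∀ z ∈ Set.Icc a b, ∀ x ∈ Set.Icc 0 D.L, ∀ y ∈ Set.Icc 0 D.L,
      |greenKernel D bc z x y| ≤ C := by
  obtain ⟨g₁, g₂, h₁, h₂, h⟩ := exists_continuousOn_greenKernel D bc
  have hK : IsCompact (Set.Icc a b ×ˢ Set.Icc 0 D.L ×ˢ Set.Icc 0 D.L) :=
    isCompact_Icc.prod (isCompact_Icc.prod isCompact_Icc)
  have hsub : Set.Icc a b ×ˢ Set.Icc 0 D.L ×ˢ Set.Icc 0 D.L ⊆
      Set.univ ×ˢ Set.Icc 0 D.L ×ˢ Set.Icc 0 D.L := Set.prod_mono (Set.subset_univ _) le_rfl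
  obtain ⟨C₁, hC₁⟩ := hK.exists_bound_of_continuousOn (h₁.mono hsub)
  obtain ⟨C₂, hC₂⟩ := hK.exists_bound_of_continuousOn (h₂.mono hsub)
  refine ⟨max C₁ C₂, fun z hz x hx y hy => ?_⟩
  rw [h]
  split_ifs
  · exact (hC₁ (z, x, y) ⟨hz, hx, hy⟩).trans (le_max_left _ _)
  · exact (hC₂ (z, x, y) ⟨hz, hx, hy⟩).trans (le_max_right _ _)

variable (D bc) in
/-- The weight is bounded on bounded sets of parameters. -/
theorem exists_bound_weight (a b : ℝ) : ∃ C, ∀ z ∈ Set.Icc a b, weight D bc z ≤ C := by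
  obtain ⟨C, hC⟩ := exists_bound_greenKernel D bc a b
  refine ⟨Real.sqrt (C ^ 2 * |D.L - 0| * |D.L - 0|), fun z hz => Real.sqrt_le_sqrt ?_⟩
  have hI : Set.uIoc 0 D.L ⊆ Set.Icc 0 D.L := by
    rw [Set.uIoc_of_le D.L_pos.le]
    exact Set.Ioc_subset_Icc_self
  refine (Real.le_norm_self _).trans
    (intervalIntegral.norm_integral_le_of_norm_le_const fun x hx => ?_)
  refine intervalIntegral.norm_integral_le_of_norm_le_const fun y hy => ?_
  rw [Real.norm_eq_abs, abs_pow]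
  exact pow_le_pow_left₀ (abs_nonneg _) (hC z hz x (hI hx) y (hI hy)) 2

variable (D bc z) in
theorem aestronglyMeasurable_greenKernel :
    AEStronglyMeasurable (fun p : ℝ × ℝ => greenKernel D bc z p.1 p.2)
      (((volume : Measure ℝ).restrict (Set.Icc 0 D.L)).prod
        ((volume : Measure ℝ).restrict (Set.Icc 0 D.L))) := by
  obtain ⟨g₁, g₂, h₁, h₂, h⟩ := exists_continuousOn_greenKernel D bc
  have hm : ∀ {g : ℝ × ℝ × ℝ → ℝ},
      ContinuousOn g (Set.univ ×ˢ Set.Icc 0 D.L ×ˢ Set.Icc 0 D.L) →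
      AEStronglyMeasurable (fun p : ℝ × ℝ => g (z, p.1, p.2))
        (((volume : Measure ℝ).restrict (Set.Icc 0 D.L)).prod
          ((volume : Measure ℝ).restrict (Set.Icc 0 D.L))) := fun hg => by
    rw [Measure.prod_restrict]
    exact (hg.comp (f := fun p : ℝ × ℝ => (z, p.1, p.2)) (by fun_prop)
      fun p hp => ⟨trivial, hp⟩).aestronglyMeasurable (measurableSet_Icc.prod measurableSet_Icc)
  have := AEStronglyMeasurable.piecewise (s := {p : ℝ × ℝ | p.2 < p.1})
    (measurableSet_lt measurable_snd measurable_fst) (hm h₁).restrict (hm h₂).restrict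
  refine this.congr (Eventually.of_forall fun p => ?_)
  simp only [Set.piecewise, h, Set.mem_ofPred_eq]

theorem aestronglyMeasurable_greenKernel_right {x : ℝ} (hx : x ∈ Set.Icc 0 D.L) :
    AEStronglyMeasurable (fun y => greenKernel D bc z x y)
      ((volume : Measure ℝ).restrict (Set.Icc 0 D.L)) := by
  obtain ⟨g₁, g₂, h₁, h₂, h⟩ := exists_continuousOn_greenKernel D bc
  have hm : ∀ {g : ℝ × ℝ × ℝ → ℝ},
      ContinuousOn g (Set.univ ×ˢ Set.Icc 0 D.L ×ˢ Set.Icc 0 D.L) →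
      AEStronglyMeasurable (fun y : ℝ => g (z, x, y))
        ((volume : Measure ℝ).restrict (Set.Icc 0 D.L)) := fun hg =>
    (hg.comp (f := fun y : ℝ => (z, x, y)) (by fun_prop)
      fun p hp => ⟨trivial, hx, hp⟩).aestronglyMeasurable measurableSet_Icc
  have := AEStronglyMeasurable.piecewise (s := {y : ℝ | y < x})
    measurableSet_Iio (hm h₁).restrict (hm h₂).restrict
  refine this.congr (Eventually.of_forall fun p => ?_)
  simp only [Set.piecewise, h, Set.mem_ofPred_eq]

theorem integrable_of_bound_Icc {L C : ℝ} {f : ℝ → ℝ}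
    (hf : AEStronglyMeasurable f ((volume : Measure ℝ).restrict (Set.Icc 0 L)))
    (hC : ∀ x ∈ Set.Icc 0 L, |f x| ≤ C) :
    Integrable f ((volume : Measure ℝ).restrict (Set.Icc 0 L)) :=
  Integrable.of_bound hf C ((ae_restrict_iff' measurableSet_Icc).2 (Eventually.of_forall hC))

variable (D bc z) in
/-- The deviation of the Green kernel from the kernel `κ u(x) u(y)` of rank at most one has an
integrable square. -/
theorem integrable_greenKernel_sub_sq (κ : ℝ) {u : ℝ → ℝ} (hu : ContinuousOn u (Set.Icc 0 D.L)) :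
    Integrable (fun p : ℝ × ℝ => (greenKernel D bc z p.1 p.2 - κ * u p.1 * u p.2) ^ 2)
      (((volume : Measure ℝ).restrict (Set.Icc 0 D.L)).prod
        ((volume : Measure ℝ).restrict (Set.Icc 0 D.L))) := by
  obtain ⟨C, hC⟩ := exists_bound_greenKernel D bc z z
  obtain ⟨B, hB⟩ := isCompact_Icc.exists_bound_of_continuousOn hu
  have hu2 : ContinuousOn (fun p : ℝ × ℝ => κ * u p.1 * u p.2)
      (Set.Icc 0 D.L ×ˢ Set.Icc 0 D.L) :=
    (continuousOn_const.mul (hu.comp continuousOn_fst fun p hp => hp.1)).mul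
      (hu.comp continuousOn_snd fun p hp => hp.2)
  have hm2 := hu2.aestronglyMeasurable (μ := (volume : Measure ℝ).prod volume)
    (measurableSet_Icc.prod measurableSet_Icc)
  rw [← Measure.prod_restrict] at hm2
  refine Integrable.of_bound (((aestronglyMeasurable_greenKernel D bc z).sub hm2).pow 2)
    ((C + |κ| * B * B) ^ 2) ?_
  rw [Measure.prod_restrict]
  refine (ae_restrict_iff' (measurableSet_Icc.prod measurableSet_Icc)).2
    (Eventually.of_forall fun p hp => ?_)
  have h1 := hC z ⟨le_rfl, le_rfl⟩ p.1 hp.1 p.2 hp.2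
  have h2 : |κ * u p.1 * u p.2| ≤ |κ| * B * B := by
    have hB0 : 0 ≤ B := (norm_nonneg _).trans (hB p.1 hp.1)
    rw [abs_mul, abs_mul]
    exact mul_le_mul (mul_le_mul_of_nonneg_left (hB p.1 hp.1) (abs_nonneg _)) (hB p.2 hp.2)
      (abs_nonneg _) (by positivity)
  rw [Real.norm_eq_abs, abs_pow]
  exact pow_le_pow_left₀ (abs_nonneg _) ((abs_sub _ _).trans (add_le_add h1 h2)) 2

theorem integral_sq_pos {L : ℝ} (hL : 0 < L) {u : ℝ → ℝ} (hu : ContinuousOn u (Set.Icc 0 L))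
    (h : ∃ x ∈ Set.Icc 0 L, u x ≠ 0) : 0 < ∫ x in (0 : ℝ)..L, u x ^ 2 := by
  obtain ⟨x, hx, hux⟩ := h
  exact intervalIntegral.integral_pos hL (hu.pow 2) (fun _ _ => sq_nonneg _)
    ⟨x, hx, by positivity⟩

/-- The Green kernel is not of rank one: it does not agree with `κ u(x) u(y)`. Otherwise the
solution operator would annihilate a nonzero function `(y - a) u(y)` orthogonal to `u`. -/
theorem integral_greenKernel_sub_sq_pos (hE : evans D bc z ≠ 0) (κ : ℝ) {u : ℝ → ℝ}
    (hu : ContinuousOn u (Set.Icc 0 D.L)) (hu0 : ∃ x ∈ Set.Icc 0 D.L, u x ≠ 0) :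
    0 < ∫ x in (0 : ℝ)..D.L, ∫ y in (0 : ℝ)..D.L,
      (greenKernel D bc z x y - κ * u x * u y) ^ 2 := by
  have hint := integrable_greenKernel_sub_sq D bc z κ hu
  have e : ∫ x in (0 : ℝ)..D.L, ∫ y in (0 : ℝ)..D.L,
      (greenKernel D bc z x y - κ * u x * u y) ^ 2 =
      ∫ p : ℝ × ℝ, (greenKernel D bc z p.1 p.2 - κ * u p.1 * u p.2) ^ 2
        ∂(((volume : Measure ℝ).restrict (Set.Icc 0 D.L)).prod
        ((volume : Measure ℝ).restrict (Set.Icc 0 D.L))) := by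
    rw [integral_prod _ hint]
    simp only [intervalIntegral.integral_of_le D.L_pos.le, ← integral_Icc_eq_integral_Ioc]
  rw [e]
  refine lt_of_le_of_ne (integral_nonneg fun _ => sq_nonneg _) fun h0 => ?_
  have hz := (integral_eq_zero_iff_of_nonneg (fun _ => sq_nonneg _) hint).1 h0.symm
  have hz' := Measure.ae_ae_of_ae_prod hz
  set N := ∫ x in (0 : ℝ)..D.L, u x ^ 2 with hN
  have hNpos : 0 < N := integral_sq_pos D.L_pos hu hu0
  -- This choice of `a` makes `(y - a) u(y)` orthogonal to `u`.
  set a := (∫ y in (0 : ℝ)..D.L, y * u y ^ 2) / N with ha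
  have hfc : ContinuousOn (fun y => (((y - a) * u y : ℝ) : ℂ)) (Set.Icc 0 D.L) :=
    continuousOn_ofReal ((continuousOn_id.sub continuousOn_const).mul hu)
  obtain ⟨v, hv, hform⟩ := exists_isSolution (bc := bc) hE (memLp_of_continuousOn hfc)
  have horth : ∫ y in (0 : ℝ)..D.L, u y * ((y - a) * u y) = 0 := by
    have i1 : IntervalIntegrable (fun y => y * u y ^ 2) volume 0 D.L := by
      refine ContinuousOn.intervalIntegrable ?_
      rw [Set.uIcc_of_le D.L_pos.le]
      exact continuousOn_id.mul (hu.pow 2)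
    have i2 : IntervalIntegrable (fun y => a * u y ^ 2) volume 0 D.L := by
      refine ContinuousOn.intervalIntegrable ?_
      rw [Set.uIcc_of_le D.L_pos.le]
      exact continuousOn_const.mul (hu.pow 2)
    have e1 : ∀ y, u y * ((y - a) * u y) = y * u y ^ 2 - a * u y ^ 2 := fun y => by ring
    simp only [e1]
    rw [intervalIntegral.integral_sub i1 i2, intervalIntegral.integral_const_mul, ← hN, ha,
      div_mul_cancel₀ _ hNpos.ne', sub_self]
  have hv0 : v 0 =ᵐ[(volume : Measure ℝ).restrict (Set.Icc 0 D.L)] 0 := by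
    filter_upwards [hz', ae_restrict_mem measurableSet_Icc] with x hx hxI
    have h1 : ∫ y in (0 : ℝ)..D.L, (greenKernel D bc z x y : ℂ) * (((y - a) * u y : ℝ) : ℂ) =
        ∫ y in (0 : ℝ)..D.L, (κ * u x : ℂ) * ((u y * ((y - a) * u y) : ℝ) : ℂ) := by
      simp only [intervalIntegral.integral_of_le D.L_pos.le, ← integral_Icc_eq_integral_Ioc]
      refine integral_congr_ae ?_
      filter_upwards [hx] with y hy
      have hy' : greenKernel D bc z x y = κ * u x * u y := by
        have : (greenKernel D bc z x y - κ * u x * u y) ^ 2 = 0 := hy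
        exact sub_eq_zero.1 (pow_eq_zero_iff two_ne_zero |>.1 this)
      rw [hy']
      push_cast
      ring
    have h2 := hform x hxI
    rw [h1, intervalIntegral.integral_const_mul, intervalIntegral.integral_ofReal, horth,
      Complex.ofReal_zero, mul_zero] at h2
    exact (mul_eq_zero.1 h2).resolve_left (by exact_mod_cast hE)
  have hf0 := hv.rhs_ae_eq_zero hv0
  have hua : u =ᵐ[(volume : Measure ℝ).restrict (Set.Icc 0 D.L)] 0 := by
    have hne : ∀ᵐ y ∂(volume : Measure ℝ).restrict (Set.Icc 0 D.L), y ≠ a :=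
      ae_restrict_of_ae (by simp [ae_iff])
    filter_upwards [hf0, hne] with y hy hya
    have : (y - a) * u y = 0 := Complex.ofReal_eq_zero.1 hy
    exact (mul_eq_zero.1 this).resolve_left (sub_ne_zero.2 hya)
  obtain ⟨x, hx, hux⟩ := hu0
  exact hux (Measure.eqOn_Icc_of_ae_eq volume D.L_pos.ne hua hu continuousOn_const hx)

theorem sq_weight : weight D bc z ^ 2 =
    ∫ x in (0 : ℝ)..D.L, ∫ y in (0 : ℝ)..D.L, greenKernel D bc z x y ^ 2 :=
  Real.sq_sqrt (intervalIntegral.integral_nonneg D.L_pos.le fun _ _ =>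
    intervalIntegral.integral_nonneg D.L_pos.le fun _ _ => sq_nonneg _)

theorem weight_pos (hE : evans D bc z ≠ 0) : 0 < weight D bc z := by
  have h := integral_greenKernel_sub_sq_pos hE 0 (u := fun _ => 1) continuousOn_const
    ⟨0, ⟨le_rfl, D.L_pos.le⟩, one_ne_zero⟩
  simp only [zero_mul, sub_zero] at h
  exact Real.sqrt_pos.2 h

/-- An eigenvalue `τ` of the integral operator with kernel `G` is strictly smaller in modulus than
the Hilbert–Schmidt norm `W`: with `u` the eigenfunction and `N = ∫ u²`, the kernel
`G - (τ / N) u ⊗ u` has squared norm `W² - τ²`, and it does not vanish. -/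
theorem sq_lt_sq_weight (hE : evans D bc z ≠ 0) {u : ℝ → ℝ} {τ : ℝ}
    (hu : ContinuousOn u (Set.Icc 0 D.L)) (hu0 : ∃ x ∈ Set.Icc 0 D.L, u x ≠ 0)
    (hτ : ∀ x ∈ Set.Icc 0 D.L, ∫ y in (0 : ℝ)..D.L, greenKernel D bc z x y * u y = τ * u x) :
    τ ^ 2 < weight D bc z ^ 2 := by
  set N := ∫ x in (0 : ℝ)..D.L, u x ^ 2 with hN
  have hNpos : 0 < N := integral_sq_pos D.L_pos hu hu0
  have h := integral_greenKernel_sub_sq_pos hE (τ / N) hu hu0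
  obtain ⟨C, hC⟩ := exists_bound_greenKernel D bc z z
  obtain ⟨B, hB⟩ := isCompact_Icc.exists_bound_of_continuousOn hu
  have hui : IntervalIntegrable (fun x => u x ^ 2) volume 0 D.L := by
    refine ContinuousOn.intervalIntegrable ?_
    rw [Set.uIcc_of_le D.L_pos.le]
    exact hu.pow 2
  have hinner : ∀ x ∈ Set.Icc 0 D.L,
      ∫ y in (0 : ℝ)..D.L, (greenKernel D bc z x y - τ / N * u x * u y) ^ 2 =
        (∫ y in (0 : ℝ)..D.L, greenKernel D bc z x y ^ 2) - τ ^ 2 / N * u x ^ 2 := fun x hx => by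
    have hm := aestronglyMeasurable_greenKernel_right (bc := bc) (z := z) hx
    have i1 : IntervalIntegrable (fun y => greenKernel D bc z x y ^ 2) volume 0 D.L := by
      rw [intervalIntegrable_iff_integrableOn_Icc_of_le D.L_pos.le]
      refine integrable_of_bound_Icc (hm.pow 2) (C := C ^ 2) fun y hy => ?_
      rw [abs_pow]
      exact pow_le_pow_left₀ (abs_nonneg _) (hC z ⟨le_rfl, le_rfl⟩ x hx y hy) 2
    have i2 : IntervalIntegrable (fun y => greenKernel D bc z x y * u y) volume 0 D.L := by
      rw [intervalIntegrable_iff_integrableOn_Icc_of_le D.L_pos.le]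
      refine integrable_of_bound_Icc (hm.mul (hu.aestronglyMeasurable measurableSet_Icc))
        (C := C * B) fun y hy => ?_
      have h1 := hC z ⟨le_rfl, le_rfl⟩ x hx y hy
      rw [abs_mul]
      exact mul_le_mul h1 (hB y hy) (abs_nonneg _) ((abs_nonneg _).trans h1)
    have e : ∀ y, (greenKernel D bc z x y - τ / N * u x * u y) ^ 2 =
        greenKernel D bc z x y ^ 2 - 2 * (τ / N * u x) * (greenKernel D bc z x y * u y) +
          (τ / N * u x) ^ 2 * u y ^ 2 := fun y => by ring
    simp only [e]
    rw [intervalIntegral.integral_add (i1.sub (i2.const_mul _)) (hui.const_mul _),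
      intervalIntegral.integral_sub i1 (i2.const_mul _), intervalIntegral.integral_const_mul,
      intervalIntegral.integral_const_mul, hτ x hx, ← hN]
    field_simp
    ring
  have hiG : IntervalIntegrable (fun x => ∫ y in (0 : ℝ)..D.L, greenKernel D bc z x y ^ 2)
      volume 0 D.L := by
    rw [intervalIntegrable_iff_integrableOn_Icc_of_le D.L_pos.le]
    have := (integrable_greenKernel_sub_sq D bc z 0 hu).integral_prod_left
    simpa only [zero_mul, sub_zero, intervalIntegral.integral_of_le D.L_pos.le,
      ← integral_Icc_eq_integral_Ioc, IntegrableOn] using this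
  rw [intervalIntegral.integral_congr (fun x hx => hinner x (by
      rwa [Set.uIcc_of_le D.L_pos.le] at hx)),
    intervalIntegral.integral_sub hiG (hui.const_mul _), intervalIntegral.integral_const_mul,
    ← sq_weight, ← hN, div_mul_cancel₀ _ hNpos.ne'] at h
  linarith

/-- The quotient of Evans function and weight is strictly smaller than the distance to any zero of
the Evans function. -/
theorem abs_evans_div_weight_lt (hE : evans D bc z ≠ 0) {z' : ℝ} (hz' : evans D bc z' = 0) :
    |evans D bc z| / weight D bc z < |z' - z| := by
  have hne : z' - z ≠ 0 := sub_ne_zero.2 fun h => hE (h ▸ hz')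
  obtain ⟨u, v, hv, hvu, hu, hu0⟩ := exists_eigenjet (bc := bc) hz'
  have hv' : IsSolution D bc z (fun x => (z' - z : ℂ) * v 0 x) v := by
    refine ⟨hv.jet, ?_, hv.holds⟩
    filter_upwards [hv.eqn] with x hx
    rw [hx]
    ring
  have hvc : ContinuousOn (v 0) (Set.Icc 0 D.L) := hv.jet.continuousOn ⟨0, D.n_pos⟩
  obtain ⟨w, hw, hform⟩ := exists_isSolution (bc := bc) hE (f := fun x => (z' - z : ℂ) * v 0 x)
    (memLp_of_continuousOn (continuousOn_const.mul hvc))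
  have hτ : ∀ x ∈ Set.Icc 0 D.L, ∫ y in (0 : ℝ)..D.L, greenKernel D bc z x y * u y =
      evans D bc z / (z' - z) * u x := fun x hx => by
    have h1 := hform x hx
    have h2 : ∫ y in (0 : ℝ)..D.L, (greenKernel D bc z x y : ℂ) * ((z' - z : ℂ) * v 0 y) =
        (z' - z : ℂ) * ((∫ y in (0 : ℝ)..D.L, greenKernel D bc z x y * u y : ℝ) : ℂ) := by
      rw [← intervalIntegral.integral_ofReal, ← intervalIntegral.integral_const_mul]
      refine intervalIntegral.integral_congr fun y hy => ?_
      rw [Set.uIcc_of_le D.L_pos.le] at hy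
      simp only [hvu y hy]
      push_cast
      ring
    rw [← hv'.eqOn hE hw hx, hvu x hx, h2] at h1
    have h3 : evans D bc z * u x =
        (z' - z) * ∫ y in (0 : ℝ)..D.L, greenKernel D bc z x y * u y := by exact_mod_cast h1
    rw [div_mul_eq_mul_div, h3, mul_div_cancel_left₀ _ hne]
  have h := sq_lt_sq_weight hE hu hu0 hτ
  have hW := weight_pos (bc := bc) hE
  rw [sq_lt_sq, abs_div, abs_of_pos hW, div_lt_iff₀ (abs_pos.2 hne)] at h
  rw [div_lt_iff₀ hW]
  linarith

end Weight

/-! ### Convergence of the iteration -/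

/-- A sequence `s (i + 1) = s i + E (s i) / W (s i)` started at a point where the continuous
function `E` is positive increases strictly, and converges to the first zero of `E` if there is
one, provided that no step reaches a zero of `E`. -/
theorem strictMono_and_tendsto_of_step {E W : ℝ → ℝ} (hE : Continuous E)
    (hW : ∀ z, E z ≠ 0 → 0 < W z) (hWb : ∀ a b, ∃ C, ∀ z ∈ Set.Icc a b, W z ≤ C)
    (hstep : ∀ z z', E z ≠ 0 → E z' = 0 → |E z| / W z < |z' - z|) {s : ℕ → ℝ}
    (hs : ∀ i, s (i + 1) = s i + E (s i) / W (s i)) (hs0 : 0 < E (s 0)) :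
    StrictMono s ∧ ∀ zp, IsLeast {x | E x = 0 ∧ s 0 < x} zp → Tendsto s atTop (𝓝 zp) := by
  -- If `E` were not positive at the next iterate, the step would contain a zero of `E`.
  have hpos : ∀ i, 0 < E (s i) := fun i => by
    induction i with
    | zero => exact hs0
    | succ i ih =>
      by_contra! hcon
      have hW' := hW _ ih.ne'
      have hle : s i ≤ s (i + 1) := by
        rw [hs]
        linarith [div_pos ih hW']
      obtain ⟨z', hz', hz0⟩ := intermediate_value_Icc' hle hE.continuousOn ⟨hcon, ih.le⟩
      have h := hstep _ _ ih.ne' hz0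
      rw [abs_of_pos ih, abs_of_nonneg (by linarith [hz'.1])] at h
      linarith [hz'.2, hs i]
  have hmono : StrictMono s := strictMono_nat_of_lt_succ fun i => by
    rw [hs]
    linarith [div_pos (hpos i) (hW _ (hpos i).ne')]
  refine ⟨hmono, fun zp hzp => ?_⟩
  have hlt : ∀ i, s i < zp := fun i => by
    induction i with
    | zero => exact hzp.1.2
    | succ i ih =>
      have h := hstep _ _ (hpos i).ne' hzp.1.1
      rw [abs_of_pos (hpos i), abs_of_pos (by linarith)] at h
      linarith [hs i]
  obtain ⟨l, hl⟩ : ∃ l, Tendsto s atTop (𝓝 l) :=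
    ⟨_, tendsto_atTop_ciSup hmono.monotone ⟨zp, by rintro _ ⟨i, rfl⟩; exact (hlt i).le⟩⟩
  have hlz : l ≤ zp := le_of_tendsto' hl fun i => (hlt i).le
  have hil : ∀ i, s i ≤ l := hmono.monotone.ge_of_tendsto hl
  have h0l : s 0 < l := (hmono one_pos).trans_le (hil 1)
  have hEl : Tendsto (fun i => E (s i)) atTop (𝓝 (E l)) := (hE.tendsto l).comp hl
  obtain ⟨C, hC⟩ := hWb (s 0) l
  -- The values of `E` are at most `C` times the steps, which tend to zero.
  have hbound : ∀ i, E (s i) ≤ C * (s (i + 1) - s i) := fun i => by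
    have hWi := hW _ (hpos i).ne'
    have h1 : E (s i) = W (s i) * (s (i + 1) - s i) := by
      rw [hs, add_sub_cancel_left, mul_div_cancel₀ _ hWi.ne']
    rw [h1]
    exact mul_le_mul_of_nonneg_right (hC _ ⟨hmono.monotone (Nat.zero_le i), hil i⟩)
      (sub_nonneg.2 (hmono.monotone (Nat.le_succ i)))
  have hstep0 : Tendsto (fun i => C * (s (i + 1) - s i)) atTop (𝓝 0) := by
    simpa using ((hl.comp (tendsto_add_atTop_nat 1)).sub hl).const_mul C
  have hEl0 : E l = 0 := le_antisymm (le_of_tendsto_of_tendsto' hEl hstep0 hbound)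
    (ge_of_tendsto' hEl fun i => (hpos i).le)
  rwa [le_antisymm hlz (hzp.2 ⟨hEl0, h0l⟩)] at hl

end EvansNewton
end

theorem mainTheorem2 (D : EvansNewton.RealDiffExpr) (bc : EvansNewton.BoundaryCondition D.n)
    (hsa : IsSelfAdjoint (EvansNewton.operator D bc)) (z₀ : ℝ)
    (hz₀ : (z₀ : ℂ) ∈ EvansNewton.resolventSet (EvansNewton.operator D bc))
    (hE : 0 < EvansNewton.evans D bc z₀) :
    (StrictMono (EvansNewton.iterPlus D bc z₀) ∧ StrictAnti (EvansNewton.iterMinus D bc z₀)) ∧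
    (∀ zp : ℝ,
      IsLeast {x : ℝ | (x : ℂ) ∈ EvansNewton.spectrum (EvansNewton.operator D bc) ∧ z₀ < x} zp →
      Tendsto (EvansNewton.iterPlus D bc z₀) atTop (𝓝 zp)) ∧
    (∀ zm : ℝ,
      IsGreatest {x : ℝ | (x : ℂ) ∈ EvansNewton.spectrum (EvansNewton.operator D bc) ∧ x < z₀} zm →
      Tendsto (EvansNewton.iterMinus D bc z₀) atTop (𝓝 zm)) := by
  have hplus := EvansNewton.strictMono_and_tendsto_of_step (EvansNewton.continuous_evans D bc)
    (fun z => EvansNewton.weight_pos) (EvansNewton.exists_bound_weight D bc)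
    (fun z z' h h' => EvansNewton.abs_evans_div_weight_lt h h') (s := EvansNewton.iterPlus D bc z₀)
    (fun i => rfl) hE
  -- The decreasing iteration is the increasing one for the reflected functions `E(-z)`, `W(-z)`.
  have hminus := EvansNewton.strictMono_and_tendsto_of_step
    (E := fun z => EvansNewton.evans D bc (-z)) (W := fun z => EvansNewton.weight D bc (-z))
    ((EvansNewton.continuous_evans D bc).comp continuous_neg)
    (fun z => EvansNewton.weight_pos)
    (fun a b => by
      obtain ⟨C, hC⟩ := EvansNewton.exists_bound_weight D bc (-b) (-a)
      exact ⟨C, fun z hz => hC _ ⟨neg_le_neg hz.2, neg_le_neg hz.1⟩⟩)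
    (fun z z' h h' => by
      have := EvansNewton.abs_evans_div_weight_lt h h'
      rwa [neg_sub_neg, abs_sub_comm] at this)
    (s := fun i => -EvansNewton.iterMinus D bc z₀ i)
    (fun i => by
      simp only [neg_neg]
      rw [EvansNewton.iterMinus, neg_sub, sub_eq_neg_add])
    (by simpa [EvansNewton.iterMinus] using hE)
  refine ⟨⟨hplus.1, fun i j hij => neg_lt_neg_iff.1 (hminus.1 hij)⟩, fun zp hzp => hplus.2 zp ?_,
    fun zm hzm => ?_⟩
  · simpa only [EvansNewton.mem_spectrum_iff hsa, EvansNewton.iterPlus] using hzp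
  · have h := hminus.2 (-zm) ⟨⟨?_, ?_⟩, fun x hx => ?_⟩
    · simpa using h.neg
    · simpa using (EvansNewton.mem_spectrum_iff hsa).1 hzm.1.1
    · exact neg_lt_neg hzm.1.2
    · exact neg_le.1 (hzm.2 ⟨(EvansNewton.mem_spectrum_iff hsa).2 hx.1, neg_lt.1 hx.2⟩)
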